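/- **The surface.** Let $\mathbb L_{\ge 0}=\omega_1\times[0,1)$ be the closed long ray with the lexicographic order; write its point $(\alpha,r)$ as $\alpha+r$, identify $\alpha\in\omega_1$ with $(\alpha,0)$, and put $\mathbb L_+=\mathbb L_{\ge0}\setminus\{0\}$. Let $\langle f_\alpha\rangle_{\alpha<\omega_1}$ be a sequence of increasing functions $f_\alpha:\omega\to\omega$ such that $f_\alpha<^*f_\beta$ whenever $\alpha<\beta$ (that is, $f_\alpha(m)<f_\beta(m)$ for all large $m$), $f_0(n)=n$ for all $n$, $f_0(n)<f_\alpha(n)$ for all $n$ and all $\alpha>0$, and $f_{\alpha+1}=f_\alpha+1$. For $x=\alpha+r\in\mathbb L_{\ge0}$ ($r\in[0,1)$) put $f_x(n)=f_\alpha(n)+r$, and let $g_x:\mathbb R\to(-\infty,0]$ be the even function with $g_x(0)=0$, $g_x(\pm\frac1n)=-\frac1{f_x(n)}$ for $n\ge1$, affine on each interval $\pm[\frac1{n+1},\frac1n]$, and constant equal to $g_x(1)$ for $|s|\ge1$. The Nyikos surface is the set $(\mathbb R^2\setminus\{(0,0)\})\sqcup\mathbb L_{\ge0}$ with the topology generated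 by the open subsets of $\mathbb R^2\setminus\{(0,0)\}$, the sets $$U(\varepsilon,x,y)=\{(s,t): |s|<\varepsilon,\ g_x(s)<t<g_y(s)\}\cup(x,y)\qquad(\varepsilon>0,\ x,y\in\mathbb L_+,\ x<y),$$ and the sets $V_\varepsilon=\{(s,t): |s|<\varepsilon,\ -\varepsilon<t<g_\varepsilon(s)\}\cup[0,\varepsilon)$ for real $\varepsilon>0$. Let $X$ be its subspace consisting of the quadrant $Q=\{(s,t): s>0,\ t<0\}$ and of $\mathbb L_{\ge0}\setminus\omega_1=\bigsqcup_{\alpha<\omega_1}(\alpha,\alpha+1)$. Let $M$ be the quotient space of $X$ obtained by identifying $\alpha+r$ with $\alpha+(1-r)$ for all $\alpha<\omega_1$ and $r\in(0,1)$ (each interval $(\alpha,\alpha+1)$ is folded around $\alpha+\frac12$: it is "Moorized"). A *surface* is a connected Hausdorff space that is locally homeomorphic to $\mathbb R^2$. A *foliation* of a space locally homeomorphic to $\mathbb R^2$ is a one-dimensional topological foliation: a maximal atlas of charts into $\mathbb R\times\mathbb R$ whose coordinate changes are locally of the form $(x,y)\mapsto(g(x,y),h(y))$, with $h$ an embedding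 of an open set of reals into $\mathbb R$. **Theorem.** Sequences $\langle f_\alpha\rangle$ as above exist. For every such sequence, $M$ is a surface which is separable, simply connected and not metrisable, and for every compact subset $K\subset M$ the space $M\setminus K$ has no foliation (in particular, taking $K=\emptyset$, $M$ has none). -/

import Mathlib

open Topology Filter
open scoped Ordinal

noncomputable section

/-! ### Surfaces and one-dimensional foliations -/

/-- A surface (without boundary): a connected Hausdorff space in which every point has an open
neighbourhood homeomorphic to an open subset of the Euclidean plane. -/
structure IsSurface (X : Type*) [TopologicalSpace X] : Prop where
  hausdorff : T2Space X
  connected : ConnectedSpace X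
  locally_euclidean : ∀ x : X,
    ∃ e : OpenPartialHomeomorph X (EuclideanSpace ℝ (Fin 2)), x ∈ e.source

/-- The coordinate change from the chart `e` to the chart `e'` is locally of the form
`(x, y) ↦ (g (x, y), h y)` with `h` an embedding of an open set of reals into the line. -/
def FoliatedChange {X : Type*} [TopologicalSpace X] (e e' : OpenPartialHomeomorph X (ℝ × ℝ)) :
    Prop :=
  ∀ p ∈ (e.symm.trans e').source, ∃ V : Set (ℝ × ℝ),
    IsOpen V ∧ p ∈ V ∧ V ⊆ (e.symm.trans e').source ∧
    ∃ h : ℝ → ℝ, IsEmbedding ((Prod.snd '' V).domRestrict h) ∧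
      ∀ q ∈ V, ((e.symm.trans e') q).2 = h q.2

/-- A (topological) foliation of dimension one on a two-dimensional manifold `X`: a maximal atlas
of charts into `ℝ × ℝ` whose coordinate changes preserve the horizontal lines locally. -/
structure Foliation (X : Type*) [TopologicalSpace X] where
  charts : Set (OpenPartialHomeomorph X (ℝ × ℝ))
  covers : ∀ x : X, ∃ e ∈ charts, x ∈ e.source
  compatible : ∀ e ∈ charts, ∀ e' ∈ charts, FoliatedChange e e'
  maximal : ∀ e : OpenPartialHomeomorph X (ℝ × ℝ),
    (∀ e' ∈ charts, FoliatedChange e e' ∧ FoliatedChange e' e) → e ∈ charts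

/-! ### The closed long ray -/

/-- The closed long ray: the set `ω₁ × [0, 1)` with the lexicographic order. -/
abbrev LongRay : Type 1 := Set.Iio (ω₁ : Ordinal.{0}) ×ₗ Set.Ico (0 : ℝ) 1

namespace LongRay

/-- The ordinal `α` of the point `(α, r) = α + r`. -/
def ord (x : LongRay) : Ordinal.{0} := (ofLex x).1.1

/-- The real part `r` of the point `(α, r) = α + r`. -/
def frac (x : LongRay) : ℝ := (ofLex x).2.1

theorem ext_ord_frac {x y : LongRay} (h₁ : x.ord = y.ord) (h₂ : x.frac = y.frac) : x = y :=
  ofLex.injective (Prod.ext (Subtype.ext h₁) (Subtype.ext h₂))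

theorem natCast_lt_omega_one (n : ℕ) : (n : Ordinal.{0}) < ω₁ :=
  lt_of_lt_of_le (Ordinal.natCast_lt_omega0 n) (Ordinal.omega0_le_omega 1)

/-- The inclusion of `[0, ∞)` as an initial segment of the long ray. -/
def ofReal (r : ℝ) : LongRay :=
  toLex (⟨(⌊r⌋₊ : Ordinal.{0}), natCast_lt_omega_one _⟩,
    ⟨Int.fract r, Int.fract_nonneg r, Int.fract_lt_one r⟩)

/-- The endpoint of the closed long ray. -/
def zero : LongRay := ofReal 0

end LongRay

/-! ### The Nyikos surface -/

/-- An `ω₁`-sequence `(f α)` of increasing functions on the natural numbers, strictly increasing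
for eventual domination, with `f 0 n = n`, `f 0 < f α` everywhere for `α > 0`, and
`f (α + 1) = f α + 1`. The values `f α` for `α ≥ ω₁` play no role. -/
structure IsNyikosSeq (f : Ordinal.{0} → ℕ → ℕ) : Prop where
  strictMono : ∀ α < ω₁, StrictMono (f α)
  eventually_lt : ∀ α β, α < β → β < ω₁ → ∀ᶠ m in atTop, f α m < f β m
  zero_eq : ∀ n, f 0 n = n
  zero_lt : ∀ α, 0 < α → α < ω₁ → ∀ n, f 0 n < f α n
  succ_eq : ∀ α < ω₁, ∀ n, f (α + 1) n = f α n + 1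

/-- The function `f_x` for a point `x` of the long ray. If `x = λ + k + r` with `λ` zero or a limit,
`k` natural and `0 ≤ r < 1`, then `f (λ + k) n + r = f λ n + (k + r)`. -/
def nyikosF (f : Ordinal.{0} → ℕ → ℕ) (x : LongRay) (n : ℕ) : ℝ := f x.ord n + x.frac

/-- The even function with value `0` at `0`, with value `a n` at `1 / n` for `n ≥ 1`, affine on
each `[1 / (n + 1), 1 / n]`, and constant with value `a 1` on `[1, ∞)`. -/
def interpolate (a : ℕ → ℝ) (s : ℝ) : ℝ :=
  if s = 0 then 0
  else if 1 ≤ |s| then a 1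
  else
    AffineMap.lineMap (a (⌊1 / |s|⌋₊ + 1)) (a ⌊1 / |s|⌋₊)
      ((|s| - 1 / ((⌊1 / |s|⌋₊ : ℝ) + 1)) /
        (1 / (⌊1 / |s|⌋₊ : ℝ) - 1 / ((⌊1 / |s|⌋₊ : ℝ) + 1)))

/-- The function `g_x`: piecewise affine, with `g_x (± 1 / n) = - 1 / f_x n`. -/
def nyikosG (f : Ordinal.{0} → ℕ → ℕ) (x : LongRay) : ℝ → ℝ :=
  interpolate fun n => -(1 / nyikosF f x n)

/-- The underlying set of the Nyikos surface: the disjoint union of the punctured plane and the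
closed long ray. -/
inductive Nyikos (f : Ordinal.{0} → ℕ → ℕ) : Type 1
  | plane (p : {p : ℝ × ℝ // p ≠ (0, 0)}) : Nyikos f
  | ray (x : LongRay) : Nyikos f

namespace Nyikos

/-- The basic open set `U(ε, x, y)`. -/
def tube (f : Ordinal.{0} → ℕ → ℕ) (ε : ℝ) (x y : LongRay) : Set (Nyikos f) :=
  plane '' {p | |p.1.1| < ε ∧ nyikosG f x p.1.1 < p.1.2 ∧ p.1.2 < nyikosG f y p.1.1} ∪
    ray '' Set.Ioo x y

/-- The basic open neighbourhood `V_ε` of the endpoint of the long ray. -/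
def endNhd (f : Ordinal.{0} → ℕ → ℕ) (ε : ℝ) : Set (Nyikos f) :=
  plane '' {p | |p.1.1| < ε ∧ -ε < p.1.2 ∧ p.1.2 < nyikosG f (LongRay.ofReal ε) p.1.1} ∪
    ray '' Set.Iio (LongRay.ofReal ε)

/-- The topology with basis: the open sets of the punctured plane, the sets `U(ε, x, y)` for
`0 < x < y`, and the sets `V_ε`. (The sets `U(∞, x, y)` are unions of sets `U(ε, x, y)`.) -/
instance (f : Ordinal.{0} → ℕ → ℕ) : TopologicalSpace (Nyikos f) :=
  TopologicalSpace.generateFrom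
    ({W | ∃ O : Set {p : ℝ × ℝ // p ≠ (0, 0)}, IsOpen O ∧ W = plane '' O} ∪
      {W | ∃ (ε : ℝ) (x y : LongRay), 0 < ε ∧ LongRay.zero < x ∧ x < y ∧ W = tube f ε x y} ∪
      {W | ∃ ε : ℝ, 0 < ε ∧ W = endNhd f ε})

end Nyikos

/-! ### The folded quadrant -/

/-- The part of the Nyikos surface consisting of the quadrant `{(s, t) | 0 < s, t < 0}` and of the
long ray without the points of `ω₁`, that is, of the intervals `(α, α + 1)`. -/
def cutQuadrant (f : Ordinal.{0} → ℕ → ℕ) : Set (Nyikos f) :=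
  Nyikos.plane '' {p | 0 < p.1.1 ∧ p.1.2 < 0} ∪ Nyikos.ray '' {x | x.frac ≠ 0}

/-- Moorization: in each interval `(α, α + 1)` the points `α + r` and `α + (1 - r)` are identified,
so that the interval is folded around `α + 1 / 2`. -/
def moorization (f : Ordinal.{0} → ℕ → ℕ) : Setoid (cutQuadrant f) where
  r p q := p = q ∨ ∃ x y : LongRay, p.1 = Nyikos.ray x ∧ q.1 = Nyikos.ray y ∧
    x.ord = y.ord ∧ x.frac + y.frac = 1
  iseqv := by
    refine ⟨fun p => Or.inl rfl, ?_, ?_⟩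
    · rintro p q (h | ⟨x, y, hp, hq, ho, hs⟩)
      · exact Or.inl h.symm
      · exact Or.inr ⟨y, x, hq, hp, ho.symm, by linarith⟩
    · rintro p q r (rfl | ⟨x, y, hp, hq, ho, hs⟩) (rfl | ⟨y', z, hq', hr, ho', hs'⟩)
      · exact Or.inl rfl
      · exact Or.inr ⟨y', z, hq', hr, ho', hs'⟩
      · exact Or.inr ⟨x, y, hp, hq, ho, hs⟩
      · left
        have hy : y = y' := by
          have := hq.symm.trans hq'
          injection this
        subst hy
        have hxz : x = z := LongRay.ext_ord_frac (ho.trans ho') (by linarith)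
        exact Subtype.ext (by rw [hp, hr, hxz])

/-- The surface obtained from the quadrant of the Nyikos surface by removing `ω₁` and Moorizing
the intervals `(α, α + 1)`, with the quotient topology. -/
def MoorizedNyikos (f : Ordinal.{0} → ℕ → ℕ) : Type 1 := Quotient (moorization f)

instance (f : Ordinal.{0} → ℕ → ℕ) : TopologicalSpace (MoorizedNyikos f) :=
  inferInstanceAs (TopologicalSpace (Quotient (moorization f)))

end

noncomputable section

/-! ### Existence of the sequences -/

/-! Around each folded interval there is a chart. The half-strip `HalfStrip` parametrizes one side
of `(α, α + 1)`: the imaginary part is the first coordinate `s`, and the real part plus `1/2` is the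
parameter `r` of the curve `stripHeight (f α) r`. Squaring folds the half-strip along its boundary
onto the interior of a parabola, and the folded interval becomes the part of the nonnegative real
axis in that region, with its `tip` at `0`. Write `width` for `s`, extended by `0`. Eventual
domination makes the charts of two ordinals disjoint at small width, with the larger ordinal above
(`exists_coord_snd_lt`, `exists_le_width_of_ne`). This gives the Hausdorff property. It also shows
that uncountably many tips each lie in no chart but their own, which excludes second countability
and hence, by separability, a metric.

A loop is compact and meets only finitely many of the arcs `width = 0`. In the chart, a compactly
supported shift to the left pushes the loop past the tip of one such arc and creates no new
intersections (`exists_homotopic_disjoint`). After finitely many pushes the loop lies in the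
quadrant, which is convex.

Suppose now that the complement of a compact `K` is foliated. All but finitely many tips lie in the
complement. The leaf through a tip continues on both sides of it, while the arc has its end there,
so the leaf must leave the arc. A piece of it therefore runs from width `0` to some width `1/(n+1)`
inside the chart (`exists_isLanding`). One `n` serves uncountably many `α`. Landing pieces of
different ordinals have disjoint interiors: if two interiors met, one would contain the other,
against the disjointness of the charts at small width. Hence they cannot change their order while
crossing the strip (`im_le_im_of_disjoint`), and the heights of their ends on the line `s = 1/(n+1)`
are monotone in `α`. A monotone real function on an uncountable set of countable ordinals takes some
value three times (`exists_three_eq_of_monotoneOn`). But three leaf arcs with disjoint interiors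
cannot end at one point, since a leaf has only two sides there (`LeafArc.false_of_three`). -/

/-- Countably many sequences of natural numbers have a strictly increasing common dominating
sequence that lies above the identity. -/
theorem exists_dominating {ι : Type*} [Countable ι] (F : ι → ℕ → ℕ) :
    ∃ g : ℕ → ℕ, StrictMono g ∧ (∀ i, ∀ᶠ m in atTop, F i m < g m) ∧ ∀ n, n < g n := by
  obtain ⟨c, hc⟩ := exists_injective_nat ι
  classical
  let E : ℕ → ℕ → ℕ := fun k m => if h : ∃ i, c i = k then F h.choose m else 0
  have hE : ∀ i m, E (c i) m = F i m := by
    intro i m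
    have h : ∃ j, c j = c i := ⟨i, rfl⟩
    have : h.choose = i := hc h.choose_spec
    simp only [E, dif_pos h, this]
  -- Diagonal argument: `S m` exceeds the first `m + 1` sequences at `m`. The partial sums of `S`
  -- are the dominating sequence. The summand `1` makes them strictly increasing and larger than the
  -- identity.
  let S : ℕ → ℕ := fun m => ∑ k ∈ Finset.range (m + 1), E k m + 1
  have hmono : StrictMono fun n => ∑ m ∈ Finset.range (n + 1), S m := by
    refine strictMono_nat_of_lt_succ fun n => ?_
    rw [Finset.sum_range_succ _ (n + 1)]
    simp only [S]
    omega
  refine ⟨_, hmono, fun i => ?_, fun n => ?_⟩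
  · filter_upwards [eventually_ge_atTop (c i)] with m hm
    rw [← hE i m]
    have h1 : E (c i) m ≤ ∑ k ∈ Finset.range (m + 1), E k m :=
      Finset.single_le_sum (f := fun k => E k m) (fun _ _ => Nat.zero_le _)
        (Finset.mem_range.2 (by omega))
    have h2 : S m ≤ ∑ m ∈ Finset.range (m + 1), S m :=
      Finset.single_le_sum (f := S) (fun _ _ => Nat.zero_le _) (Finset.self_mem_range_succ m)
    simp only [S] at h1 h2 ⊢
    omega
  · have : ∑ m ∈ Finset.range (n + 1), 1 ≤ ∑ m ∈ Finset.range (n + 1), S m :=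
      Finset.sum_le_sum fun m _ => by simp [S]
    simp at this
    omega

theorem countable_Iio_of_lt_omega_one {β : Ordinal.{0}} (hβ : β < ω₁) : (Set.Iio β).Countable := by
  rw [← Cardinal.le_aleph0_iff_set_countable, Cardinal.mk_Iio_ordinal, Cardinal.lift_le_aleph0]
  have := Cardinal.lt_ord.1 (by simpa using hβ : β < (Cardinal.aleph 1).ord)
  rwa [← Cardinal.succ_aleph0, Order.lt_succ_iff] at this

open Classical in
/-- One step of the transfinite recursion. -/
def nyikosStep (β : Ordinal.{0}) (prev : ∀ α, α < β → ℕ → ℕ) : ℕ → ℕ :=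
  if β = 0 then id
  else if h : ∃ γ, β = γ + 1 then
    fun n => prev h.choose ((lt_add_one h.choose).trans_eq h.choose_spec.symm) n + 1
  else if h : ∃ g : ℕ → ℕ, StrictMono g ∧ (∀ α (hα : α < β), ∀ᶠ m in atTop, prev α hα m < g m) ∧
      ∀ n, n < g n then h.choose
  else id

/-- A sequence as in `IsNyikosSeq`, by transfinite recursion. -/
def nyikosSeq : Ordinal.{0} → ℕ → ℕ := WellFoundedLT.fix nyikosStep

theorem nyikosSeq_eq (β : Ordinal.{0}) :
    nyikosSeq β = nyikosStep β fun α _ => nyikosSeq α :=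
  WellFoundedLT.fix_eq _ _

theorem nyikosSeq_zero : nyikosSeq 0 = id := by
  rw [nyikosSeq_eq, nyikosStep, if_pos rfl]

theorem nyikosSeq_succ (γ : Ordinal.{0}) (n : ℕ) : nyikosSeq (γ + 1) n = nyikosSeq γ n + 1 := by
  have h : ∃ δ, γ + 1 = δ + 1 := ⟨γ, rfl⟩
  have hc : h.choose = γ := (Order.succ_injective (by simp)).symm
  rw [nyikosSeq_eq, nyikosStep, if_neg (by simp), dif_pos h, hc]

/-- Below a countable limit there are only countably many sequences, so `exists_dominating` supplies
a candidate and the default branch `id` of `nyikosStep` is not taken. -/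
theorem nyikosSeq_limit {β : Ordinal.{0}} (h0 : β ≠ 0) (hs : ¬ ∃ γ, β = γ + 1) (hβ : β < ω₁) :
    StrictMono (nyikosSeq β) ∧ (∀ α < β, ∀ᶠ m in atTop, nyikosSeq α m < nyikosSeq β m) ∧
      ∀ n, n < nyikosSeq β n := by
  have : ∃ g : ℕ → ℕ, StrictMono g ∧
      (∀ α (_ : α < β), ∀ᶠ m in atTop, nyikosSeq α m < g m) ∧ ∀ n, n < g n := by
    have := (countable_Iio_of_lt_omega_one hβ).to_subtype
    obtain ⟨g, h1, h2, h3⟩ := exists_dominating fun α : Set.Iio β => nyikosSeq α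
    exact ⟨g, h1, fun α hα => h2 ⟨α, hα⟩, h3⟩
  have heq : nyikosSeq β = this.choose := by
    conv_lhs => rw [nyikosSeq_eq, nyikosStep]
    rw [if_neg h0, dif_neg hs, dif_pos this]
  rw [heq]
  exact this.choose_spec

theorem isNyikosSeq_nyikosSeq : IsNyikosSeq nyikosSeq := by
  have key : ∀ β < ω₁, StrictMono (nyikosSeq β) ∧
      (∀ α < β, ∀ᶠ m in atTop, nyikosSeq α m < nyikosSeq β m) ∧
      (0 < β → ∀ n, n < nyikosSeq β n) := by
    intro β
    induction β using WellFoundedLT.induction with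
    | ind β ih =>
      intro hβ
      rcases eq_or_ne β 0 with rfl | h0
      · rw [nyikosSeq_zero]
        exact ⟨strictMono_id, fun α hα => absurd hα (not_lt_bot), fun h => absurd h (lt_irrefl _)⟩
      by_cases hs : ∃ γ, β = γ + 1
      · obtain ⟨γ, rfl⟩ := hs
        obtain ⟨h1, h2, h3⟩ := ih γ (lt_add_one γ) ((lt_add_one γ).trans hβ)
        refine ⟨fun m n hmn => ?_, fun α hα => ?_, fun _ n => ?_⟩
        · have := h1 hmn
          simp only [nyikosSeq_succ]
          omega
        · rcases (Order.lt_add_one_iff.1 hα).lt_or_eq with h | rfl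
          · filter_upwards [h2 α h] with m hm
            rw [nyikosSeq_succ]
            omega
          · exact .of_forall fun m => by rw [nyikosSeq_succ]; omega
        · rw [nyikosSeq_succ]
          rcases eq_or_ne γ 0 with rfl | hγ
          · simp [nyikosSeq_zero]
          · have := h3 (pos_iff_ne_zero.2 hγ) n
            omega
      · obtain ⟨h1, h2, h3⟩ := nyikosSeq_limit h0 hs hβ
        exact ⟨h1, h2, fun _ => h3⟩
  exact
    { strictMono := fun α hα => (key α hα).1
      eventually_lt := fun α β h hβ => (key β hβ).2.1 α h
      zero_eq := fun n => by rw [nyikosSeq_zero]; rfl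
      zero_lt := fun α h hα n => by rw [nyikosSeq_zero]; exact (key α hα).2.2 h n
      succ_eq := fun α _ n => nyikosSeq_succ α n }

/-! ### The piecewise affine functions -/

theorem floor_one_div_eq {s : ℝ} {n : ℕ} (hn : 1 ≤ n) (h1 : 1 / ((n : ℝ) + 1) < s)
    (h2 : s ≤ 1 / (n : ℝ)) : ⌊1 / s⌋₊ = n := by
  have hn' : (0 : ℝ) < n := by exact_mod_cast hn
  have hs : 0 < s := lt_trans (by positivity) h1
  rw [Nat.floor_eq_iff (by positivity)]
  constructor
  · rw [le_div_iff₀ hs]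
    rwa [le_div_iff₀ hn', mul_comm] at h2
  · rw [div_lt_iff₀ hs]
    rwa [div_lt_iff₀ (by positivity), mul_comm] at h1

theorem exists_level {s : ℝ} (hs : 0 < s) (h1 : s ≤ 1) :
    ∃ n : ℕ, 1 ≤ n ∧ ⌊1 / s⌋₊ = n ∧ 1 / ((n : ℝ) + 1) < s ∧ s ≤ 1 / (n : ℝ) := by
  have h : (1 : ℝ) ≤ 1 / s := by rwa [le_div_iff₀ hs, one_mul]
  have hn : 1 ≤ ⌊1 / s⌋₊ := Nat.le_floor (by simpa using h)
  have hn' : (0 : ℝ) < ⌊1 / s⌋₊ := by exact_mod_cast hn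
  refine ⟨_, hn, rfl, ?_, ?_⟩
  · rw [div_lt_iff₀ (by positivity), mul_comm, ← div_lt_iff₀ hs]
    exact Nat.lt_floor_add_one _
  · rw [le_div_iff₀ hn', mul_comm, ← le_div_iff₀ hs]
    exact Nat.floor_le (by positivity)

theorem interpolate_of_one_le (a : ℕ → ℝ) {s : ℝ} (hs : 1 ≤ s) : interpolate a s = a 1 := by
  have h0 : 0 < s := by linarith
  rw [interpolate, if_neg h0.ne', if_pos (by rwa [abs_of_pos h0])]

/-- The affine formula for `interpolate` on `[1 / (n + 1), 1 / n]`. -/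
theorem interpolate_of_mem (a : ℕ → ℝ) {n : ℕ} (hn : 1 ≤ n) {s : ℝ} (h1 : 1 / ((n : ℝ) + 1) ≤ s)
    (h2 : s ≤ 1 / (n : ℝ)) :
    interpolate a s = AffineMap.lineMap (a (n + 1)) (a n)
      ((s - 1 / ((n : ℝ) + 1)) / (1 / (n : ℝ) - 1 / ((n : ℝ) + 1))) := by
  have hn' : (0 : ℝ) < n := by exact_mod_cast hn
  have gap : ∀ m : ℕ, 1 ≤ m → 1 / (m : ℝ) - 1 / ((m : ℝ) + 1) ≠ 0 := by
    intro m hm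
    have : (0 : ℝ) < m := by exact_mod_cast hm
    exact (sub_pos.2 (one_div_lt_one_div_of_lt this (by linarith))).ne'
  have hs : 0 < s := lt_of_lt_of_le (by positivity) h1
  rcases h1.eq_or_lt with h1 | h1
  · rw [← h1, sub_self, zero_div, AffineMap.lineMap_apply_zero, interpolate, if_neg (by positivity),
      abs_of_pos (by positivity), if_neg]
    · have hf : ⌊1 / (1 / ((n : ℝ) + 1))⌋₊ = n + 1 := by
        rw [one_div_one_div]; exact_mod_cast Nat.floor_natCast (n + 1)
      rw [hf]
      have := gap (n + 1) (by omega)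
      push_cast at this ⊢
      rw [div_self this, AffineMap.lineMap_apply_one]
    · rw [not_le, div_lt_one (by positivity)]; linarith
  rcases lt_or_ge s 1 with hs1 | hs1
  · rw [interpolate, if_neg hs.ne', abs_of_pos hs, if_neg (not_le.2 hs1), floor_one_div_eq hn h1 h2]
  · have : n = 1 := by
      have : (1 : ℝ) ≤ 1 / n := hs1.trans h2
      rw [le_div_iff₀ hn', one_mul] at this
      exact le_antisymm (by exact_mod_cast this) hn
    subst this
    have hs1 : s = 1 := le_antisymm (by simpa using h2) hs1
    rw [interpolate_of_one_le a hs1.ge, hs1]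
    norm_num

/-- The common form of a value of `interpolate`: a convex combination of two consecutive values. -/
theorem exists_interpolate_eq {s : ℝ} (hs : 0 < s) : ∃ (n : ℕ) (θ : ℝ), 1 ≤ n ∧ 0 ≤ θ ∧ θ ≤ 1 ∧
    (1 / ((n : ℝ) + 1)) < s ∧ ∀ a : ℕ → ℝ, interpolate a s = (1 - θ) * a (n + 1) + θ * a n := by
  rcases le_total 1 s with h | h
  · exact ⟨1, 1, le_rfl, zero_le_one, le_rfl, by norm_num; linarith,
      fun a => by rw [interpolate_of_one_le a h]; ring⟩
  · obtain ⟨n, hn, -, h1, h2⟩ := exists_level hs h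
    have hn' : (0 : ℝ) < n := by exact_mod_cast hn
    have gap : 0 < 1 / (n : ℝ) - 1 / ((n : ℝ) + 1) :=
      sub_pos.2 (one_div_lt_one_div_of_lt hn' (by linarith))
    refine ⟨n, _, hn, div_nonneg (sub_nonneg.2 h1.le) gap.le,
      (div_le_one gap).2 (by linarith), h1, fun a => ?_⟩
    rw [interpolate_of_mem a hn h1.le h2, AffineMap.lineMap_apply_ring]

/-- The value at `s` is a convex combination of the terms `n` and `n + 1` with `1/(n+1) < s`. If `s
≤ 1/(N+1)`, both indices are at least `N`. This is how eventual domination becomes an inequality of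
functions near `0`. -/
theorem interpolate_lt {a b : ℕ → ℝ} {N : ℕ} {s : ℝ} (hs : 0 < s)
    (hN : s * ((N : ℝ) + 1) ≤ 1) (hab : ∀ n, 1 ≤ n → N ≤ n → a n < b n) :
    interpolate a s < interpolate b s := by
  obtain ⟨n, θ, hn, h0, h1, hs', h⟩ := exists_interpolate_eq hs
  have hNn : N ≤ n := by
    rw [div_lt_iff₀ (by positivity)] at hs'
    have : (N : ℝ) + 1 < n + 1 := by
      by_contra! hh
      nlinarith
    exact_mod_cast (by linarith : (N : ℝ) ≤ n)
  have e1 := hab n hn hNn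
  have e2 := hab (n + 1) (by omega) (by omega)
  rw [h, h]
  rcases h0.eq_or_lt with rfl | h0
  · simpa using e2
  · nlinarith [mul_lt_mul_of_pos_left e1 h0, mul_le_mul_of_nonneg_left e2.le (sub_nonneg.2 h1)]

/-- The height at `s` of the curve with parameter `r` of the strip determined by `φ`. -/
def stripHeight (φ : ℕ → ℕ) (r s : ℝ) : ℝ := interpolate (fun n => -(1 / ((φ n : ℝ) + r))) s

theorem StrictMono.one_le_apply {φ : ℕ → ℕ} (hφ : StrictMono φ) {n : ℕ} (hn : 1 ≤ n) : 1 ≤ φ n :=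
  hn.trans hφ.le_apply

theorem stripHeight_strictMono {φ : ℕ → ℕ} (hφ : StrictMono φ) {r r' s : ℝ} (hs : 0 < s)
    (hr : 0 ≤ r) (h : r < r') : stripHeight φ r s < stripHeight φ r' s := by
  obtain ⟨n, θ, hn, h0, h1, -, H⟩ := exists_interpolate_eq hs
  have key : ∀ n, 1 ≤ n → -(1 / ((φ n : ℝ) + r)) < -(1 / ((φ n : ℝ) + r')) := by
    intro n hn
    have : (1 : ℝ) ≤ φ n := by exact_mod_cast hφ.one_le_apply hn
    exact neg_lt_neg (one_div_lt_one_div_of_lt (by linarith) (by linarith))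
  rw [stripHeight, stripHeight, H, H]
  have e1 := key n hn
  have e2 := key (n + 1) (by omega)
  rcases h0.eq_or_lt with rfl | h0
  · simpa using e2
  · nlinarith [mul_lt_mul_of_pos_left e1 h0, mul_le_mul_of_nonneg_left e2.le (sub_nonneg.2 h1)]

theorem stripHeight_neg {φ : ℕ → ℕ} (hφ : StrictMono φ) {r s : ℝ} (hs : 0 < s) (hr : 0 ≤ r) :
    stripHeight φ r s < 0 := by
  obtain ⟨n, θ, hn, h0, h1, -, H⟩ := exists_interpolate_eq hs
  have key : ∀ n, 1 ≤ n → -(1 / ((φ n : ℝ) + r)) < 0 := by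
    intro n hn
    have : (1 : ℝ) ≤ φ n := by exact_mod_cast hφ.one_le_apply hn
    rw [neg_lt_zero]
    positivity
  rw [stripHeight, H]
  have e1 := key n hn
  have e2 := key (n + 1) (by omega)
  rcases h0.eq_or_lt with rfl | h0
  · simpa using e2
  · nlinarith [mul_lt_mul_of_pos_left e1 h0, mul_le_mul_of_nonneg_left e2.le (sub_nonneg.2 h1)]

/-- The curves of a strip tend to `0` at `0`, uniformly. -/
theorem exists_neg_lt_stripHeight {ε : ℝ} (hε : 0 < ε) : ∃ δ > 0, ∀ (φ : ℕ → ℕ), StrictMono φ →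
    ∀ r s : ℝ, 0 ≤ r → 0 < s → s < δ → -ε < stripHeight φ r s := by
  obtain ⟨N, hN⟩ := exists_nat_one_div_lt hε
  refine ⟨1 / ((N : ℝ) + 1 + 1), by positivity, fun φ hφ r s hr hs hsδ => ?_⟩
  -- The constant is viewed as an interpolated sequence so that `interpolate_lt` applies. The
  -- resulting bound depends only on `n ≤ φ n`, hence the uniformity in `φ` and `r`.
  have : -ε = interpolate (fun _ => -ε) s := by
    obtain ⟨n, θ, -, -, -, -, H⟩ := exists_interpolate_eq hs
    rw [H]; ring
  rw [this, stripHeight]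
  refine interpolate_lt (N := N + 1) hs ?_ fun n hn hNn => ?_
  · rw [lt_div_iff₀ (by positivity)] at hsδ
    push_cast
    exact hsδ.le
  · rw [neg_lt_neg_iff]
    refine lt_of_le_of_lt (one_div_le_one_div_of_le (by positivity) ?_) hN
    have h1 : (N : ℝ) + 1 ≤ n := by exact_mod_cast hNn
    have h2 : (n : ℝ) ≤ φ n := by exact_mod_cast hφ.le_apply
    linarith

/-- Strips of different ordinals are disjoint near `0`. -/
theorem exists_stripHeight_lt {f : Ordinal.{0} → ℕ → ℕ} (hf : IsNyikosSeq f) {α β : Ordinal.{0}}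
    (h : α < β) (hβ : β < ω₁) : ∃ δ > 0, ∀ r r' s : ℝ, 0 ≤ r → r < 1 → 0 ≤ r' → 0 < s → s < δ →
      stripHeight (f α) r s < stripHeight (f β) r' s := by
  obtain ⟨N, hN⟩ := eventually_atTop.1 (hf.eventually_lt α β h hβ)
  refine ⟨1 / ((N : ℝ) + 1), by positivity, fun r r' s hr hr1 hr' hs hsδ => ?_⟩
  refine interpolate_lt (N := N) hs ?_ fun n hn hNn => ?_
  · rw [lt_div_iff₀ (by positivity)] at hsδ
    exact hsδ.le
  · rw [neg_lt_neg_iff]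
    have h1 : (1 : ℝ) ≤ f α n := by
      exact_mod_cast (hf.strictMono α (h.trans hβ)).one_le_apply hn
    -- For integers, strict domination is a gap of at least `1`, which exceeds any `r < 1`.
    have h2 : (f α n : ℝ) + 1 ≤ f β n := by exact_mod_cast hN n hNn
    exact one_div_lt_one_div_of_lt (by linarith) (by linarith)

/-- On `1 ≤ s` and on each band `1/(n+2) ≤ s ≤ 1/(n+1)` there is an explicit formula, jointly
continuous in `r` and `s`. Finitely many closed bands are glued by induction, and every point with
`s > 0` is interior, in the `s` direction, to such a union. -/
theorem continuousOn_stripHeight {φ : ℕ → ℕ} (hφ : StrictMono φ) :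
    ContinuousOn (fun p : ℝ × ℝ => stripHeight φ p.1 p.2) {p | 0 ≤ p.1 ∧ 0 < p.2} := by
  have key : ∀ n : ℕ, ContinuousOn (fun p : ℝ × ℝ => stripHeight φ p.1 p.2)
      {p | 0 ≤ p.1 ∧ 1 / ((n : ℝ) + 1) ≤ p.2} := by
    intro n
    induction n with
    | zero =>
      have : ContinuousOn (fun p : ℝ × ℝ => -(1 / ((φ 1 : ℝ) + p.1)))
          {p | 0 ≤ p.1 ∧ 1 / (((0 : ℕ) : ℝ) + 1) ≤ p.2} := by
        refine (ContinuousOn.div (by fun_prop) (by fun_prop) ?_).neg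
        rintro p ⟨hp, -⟩
        have : (1 : ℝ) ≤ φ 1 := by exact_mod_cast hφ.one_le_apply le_rfl
        linarith
      refine this.congr ?_
      rintro p ⟨-, hp⟩
      exact interpolate_of_one_le _ (by simpa using hp)
    | succ n ih =>
      have h2 : ContinuousOn (fun p : ℝ × ℝ => stripHeight φ p.1 p.2)
          {p | 0 ≤ p.1 ∧ 1 / (((n + 1 : ℕ) : ℝ) + 1) ≤ p.2 ∧ p.2 ≤ 1 / ((n + 1 : ℕ) : ℝ)} := by
        have : ContinuousOn (fun p : ℝ × ℝ => AffineMap.lineMap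
            (-(1 / ((φ (n + 1 + 1) : ℝ) + p.1))) (-(1 / ((φ (n + 1) : ℝ) + p.1)))
            ((p.2 - 1 / (((n + 1 : ℕ) : ℝ) + 1)) /
              (1 / ((n + 1 : ℕ) : ℝ) - 1 / (((n + 1 : ℕ) : ℝ) + 1))))
          {p | 0 ≤ p.1 ∧ 1 / (((n + 1 : ℕ) : ℝ) + 1) ≤ p.2 ∧ p.2 ≤ 1 / ((n + 1 : ℕ) : ℝ)} := by
          simp only [AffineMap.lineMap_apply_ring]
          have c : ∀ m, 1 ≤ m → ContinuousOn (fun p : ℝ × ℝ => -(1 / ((φ m : ℝ) + p.1)))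
              {p | 0 ≤ p.1 ∧ 1 / (((n + 1 : ℕ) : ℝ) + 1) ≤ p.2 ∧ p.2 ≤ 1 / ((n + 1 : ℕ) : ℝ)} := by
            intro m hm
            refine (ContinuousOn.div (by fun_prop) (by fun_prop) ?_).neg
            rintro p ⟨hp, -⟩
            have : (1 : ℝ) ≤ φ m := by exact_mod_cast hφ.one_le_apply hm
            linarith
          exact (ContinuousOn.mul (by fun_prop) (c _ (by omega))).add
            (ContinuousOn.mul (by fun_prop) (c _ (by omega)))
        refine this.congr ?_
        rintro p ⟨-, hp1, hp2⟩
        exact interpolate_of_mem _ (by omega) hp1 hp2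
      refine (ContinuousOn.union_of_isClosed ih h2 ?_ ?_).mono ?_
      · exact (isClosed_le continuous_const continuous_fst).inter
          (isClosed_le continuous_const continuous_snd)
      · exact (isClosed_le continuous_const continuous_fst).inter
          ((isClosed_le continuous_const continuous_snd).inter
            (isClosed_le continuous_snd continuous_const))
      · rintro p ⟨hp, hp'⟩
        rcases le_total (1 / ((n : ℝ) + 1)) p.2 with h | h
        · exact Or.inl ⟨hp, h⟩
        · exact Or.inr ⟨hp, hp', by exact_mod_cast h⟩
  rintro ⟨r, s⟩ ⟨hr, hs⟩
  obtain ⟨n, hn⟩ := exists_nat_one_div_lt hs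
  refine ((key n) (r, s) ⟨hr, hn.le⟩).mono_of_mem_nhdsWithin ?_
  have : {p : ℝ × ℝ | 1 / ((n : ℝ) + 1) < p.2} ∈ 𝓝 (r, s) :=
    (isOpen_lt continuous_const continuous_snd).mem_nhds hn
  filter_upwards [mem_nhdsWithin_of_mem_nhds this, self_mem_nhdsWithin] with p h1 h2
  exact ⟨h2.1, le_of_lt h1⟩

theorem continuousOn_nyikosG {f : Ordinal.{0} → ℕ → ℕ} (hf : IsNyikosSeq f) (x : LongRay) :
    ContinuousOn (nyikosG f x) (Set.Ioi 0) :=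
  (continuousOn_stripHeight (hf.strictMono _ (ofLex x).1.2)).comp
    (f := fun s => (x.frac, s)) (by fun_prop) fun _ hs => ⟨(ofLex x).2.2.1, hs⟩

/-- Every height between two curves of a strip lies on a curve of the strip. -/
theorem exists_stripHeight_eq {φ : ℕ → ℕ} (hφ : StrictMono φ) {r₁ r₂ s t : ℝ} (hs : 0 < s)
    (h0 : 0 ≤ r₁) (h : r₁ ≤ r₂) (h1 : stripHeight φ r₁ s < t) (h2 : t < stripHeight φ r₂ s) :
    ∃ r ∈ Set.Ioo r₁ r₂, stripHeight φ r s = t := by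
  have : ContinuousOn (fun r => stripHeight φ r s) (Set.Icc r₁ r₂) :=
    (continuousOn_stripHeight hφ).comp (f := fun r => (r, s)) (by fun_prop)
      fun r hr => ⟨h0.trans hr.1, hs⟩
  exact intermediate_value_Ioo h this ⟨h1, h2⟩

/-! ### Points of the long ray -/

namespace LongRay

/-- The point `α + r` of the long ray. -/
def mk (α : Set.Iio (ω₁ : Ordinal.{0})) (r : ℝ) (h₀ : 0 ≤ r) (h₁ : r < 1) : LongRay :=
  toLex (α, ⟨r, h₀, h₁⟩)

@[simp] theorem ord_mk (α : Set.Iio (ω₁ : Ordinal.{0})) (r : ℝ) (h₀ : 0 ≤ r) (h₁ : r < 1) :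
    (mk α r h₀ h₁).ord = α := rfl

@[simp] theorem frac_mk (α : Set.Iio (ω₁ : Ordinal.{0})) (r : ℝ) (h₀ : 0 ≤ r) (h₁ : r < 1) :
    (mk α r h₀ h₁).frac = r := rfl

theorem ord_lt (x : LongRay) : x.ord < ω₁ := (ofLex x).1.2

theorem frac_nonneg (x : LongRay) : 0 ≤ x.frac := (ofLex x).2.2.1

theorem frac_lt_one (x : LongRay) : x.frac < 1 := (ofLex x).2.2.2

theorem lt_iff {x y : LongRay} : x < y ↔ x.ord < y.ord ∨ x.ord = y.ord ∧ x.frac < y.frac := by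
  rw [Prod.Lex.lt_iff]
  simp only [ord, frac, Subtype.ext_iff, Subtype.coe_lt_coe]

/-- Gives a point of the same unit interval as `y`, strictly between `x` and `y` and off the
ordinals, so that comparisons with arbitrary points of the ray reduce to curves of the strip of `y`.
-/
theorem exists_between_left {x y : LongRay} (hy : 0 < y.frac) (h : x < y) :
    ∃ r, 0 < r ∧ r < y.frac ∧
      (x.ord < y.ord ∨ x.ord = y.ord ∧ x.frac < r) := by
  rcases lt_iff.1 h with h | ⟨h1, h2⟩
  · exact ⟨y.frac / 2, by linarith, by linarith, Or.inl h⟩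
  · obtain ⟨r, hr1, hr2⟩ := exists_between h2
    exact ⟨r, x.frac_nonneg.trans_lt hr1, hr2, Or.inr ⟨h1, hr1⟩⟩

theorem exists_between_right {x y : LongRay} (h : x < y) :
    ∃ r, x.frac < r ∧ r < 1 ∧
      (x.ord < y.ord ∨ x.ord = y.ord ∧ r < y.frac) := by
  rcases lt_iff.1 h with h | ⟨h1, h2⟩
  · obtain ⟨r, hr1, hr2⟩ := exists_between x.frac_lt_one
    exact ⟨r, hr1, hr2, Or.inl h⟩
  · obtain ⟨r, hr1, hr2⟩ := exists_between h2
    exact ⟨r, hr1, hr2.trans y.frac_lt_one, Or.inr ⟨h1, hr2⟩⟩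

theorem zero_ord : zero.ord = 0 := by simp [zero, ofReal, ord]

theorem zero_frac : zero.frac = 0 := by simp [zero, ofReal, frac]

theorem zero_lt_of_frac_pos {x : LongRay} (hx : 0 < x.frac) : zero < x := by
  rw [lt_iff, zero_ord, zero_frac]
  rcases eq_or_ne x.ord 0 with h | h
  · exact Or.inr ⟨h.symm, hx⟩
  · exact Or.inl (pos_iff_ne_zero.2 h)

end LongRay

/-- For a smaller ordinal this is eventual domination, valid only near `0`. Within one strip it is
monotonicity in the parameter, valid everywhere, and `δ = 1` is arbitrary. -/
theorem exists_nyikosG_lt_left {f : Ordinal.{0} → ℕ → ℕ} (hf : IsNyikosSeq f) {x : LongRay}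
    {β : Ordinal.{0}} (hβ : β < ω₁) {r : ℝ} (hr : 0 ≤ r)
    (h : x.ord < β ∨ x.ord = β ∧ x.frac < r) :
    ∃ δ > 0, ∀ s : ℝ, 0 < s → s < δ → nyikosG f x s < stripHeight (f β) r s := by
  rcases h with h | ⟨rfl, h⟩
  · obtain ⟨δ, hδ, H⟩ := exists_stripHeight_lt hf h hβ
    exact ⟨δ, hδ, fun s hs hsδ => H _ _ s x.frac_nonneg x.frac_lt_one hr hs hsδ⟩
  · exact ⟨1, one_pos, fun s hs _ =>
      stripHeight_strictMono (hf.strictMono _ hβ) hs x.frac_nonneg h⟩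

theorem exists_nyikosG_lt_right {f : Ordinal.{0} → ℕ → ℕ} (hf : IsNyikosSeq f) {y : LongRay}
    {β : Ordinal.{0}} {r : ℝ} (hr : 0 ≤ r) (hr1 : r < 1)
    (h : β < y.ord ∨ β = y.ord ∧ r < y.frac) :
    ∃ δ > 0, ∀ s : ℝ, 0 < s → s < δ → stripHeight (f β) r s < nyikosG f y s := by
  rcases h with h | ⟨rfl, h⟩
  · obtain ⟨δ, hδ, H⟩ := exists_stripHeight_lt hf h y.ord_lt
    exact ⟨δ, hδ, fun s hs hsδ => H _ _ s hr hr1 y.frac_nonneg hs hsδ⟩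
  · exact ⟨1, one_pos, fun s hs _ => stripHeight_strictMono (hf.strictMono _ y.ord_lt) hs hr h⟩

/-! ### The quadrant in the Nyikos surface -/

namespace Nyikos

/-- The generating family of open sets. -/
def generators (f : Ordinal.{0} → ℕ → ℕ) : Set (Set (Nyikos f)) :=
  {W | ∃ O : Set {p : ℝ × ℝ // p ≠ (0, 0)}, IsOpen O ∧ W = plane '' O} ∪
    {W | ∃ (ε : ℝ) (x y : LongRay), 0 < ε ∧ LongRay.zero < x ∧ x < y ∧ W = tube f ε x y} ∪
    {W | ∃ ε : ℝ, 0 < ε ∧ W = endNhd f ε}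

theorem continuous_of_generators {f : Ordinal.{0} → ℕ → ℕ} {T : Type*} [TopologicalSpace T]
    {k : T → Nyikos f} (h : ∀ W ∈ generators f, ∀ t, k t ∈ W → ∀ᶠ t' in 𝓝 t, k t' ∈ W) :
    Continuous k :=
  continuous_generateFrom_iff.2 fun W hW => isOpen_iff_mem_nhds.2 fun t ht => h W hW t ht

theorem isOpen_plane_image {f : Ordinal.{0} → ℕ → ℕ} {O : Set {p : ℝ × ℝ // p ≠ (0, 0)}}
    (hO : IsOpen O) : IsOpen (plane '' O : Set (Nyikos f)) :=
  TopologicalSpace.isOpen_generateFrom_of_mem (Or.inl (Or.inl ⟨O, hO, rfl⟩))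

theorem isOpen_tube {f : Ordinal.{0} → ℕ → ℕ} {ε : ℝ} (hε : 0 < ε) {x y : LongRay}
    (hx : LongRay.zero < x) (hxy : x < y) : IsOpen (tube f ε x y) :=
  TopologicalSpace.isOpen_generateFrom_of_mem (Or.inl (Or.inr ⟨ε, x, y, hε, hx, hxy, rfl⟩))

theorem plane_mem_image {f : Ordinal.{0} → ℕ → ℕ} {O : Set {p : ℝ × ℝ // p ≠ (0, 0)}}
    {B : Set LongRay} {p : {p : ℝ × ℝ // p ≠ (0, 0)}} :
    (plane p : Nyikos f) ∈ plane '' O ∪ ray '' B ↔ p ∈ O := by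
  simp

theorem ray_mem_image {f : Ordinal.{0} → ℕ → ℕ} {O : Set {p : ℝ × ℝ // p ≠ (0, 0)}}
    {B : Set LongRay} {x : LongRay} :
    (ray x : Nyikos f) ∈ plane '' O ∪ ray '' B ↔ x ∈ B := by
  simp

/-- Each generator traces an open set on the right half-plane, because the bounding curves are
continuous at positive `s`. Hence the quadrant keeps its Euclidean topology. -/
theorem eventually_plane_mem {f : Ordinal.{0} → ℕ → ℕ} (hf : IsNyikosSeq f)
    {W : Set (Nyikos f)} (hW : W ∈ generators f) {p : {p : ℝ × ℝ // p ≠ (0, 0)}}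
    (hp : 0 < p.1.1) (hpW : plane p ∈ W) : ∀ᶠ q in 𝓝 p, plane q ∈ W := by
  have hfst : Continuous fun q : {p : ℝ × ℝ // p ≠ (0, 0)} => q.1.1 := by fun_prop
  have hsnd : Continuous fun q : {p : ℝ × ℝ // p ≠ (0, 0)} => q.1.2 := by fun_prop
  have hg : ∀ x : LongRay, ContinuousAt (fun q : {p : ℝ × ℝ // p ≠ (0, 0)} => nyikosG f x q.1.1) p :=
    fun x => ContinuousAt.comp (f := fun q : {p : ℝ × ℝ // p ≠ (0, 0)} => q.1.1)
      ((continuousOn_nyikosG hf x).continuousAt (Ioi_mem_nhds hp)) hfst.continuousAt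
  rcases hW with (⟨O, hO, rfl⟩ | ⟨ε, x, y, hε, hx, hxy, rfl⟩) | ⟨ε, hε, rfl⟩
  · obtain ⟨q, hq, h⟩ := hpW
    obtain rfl : q = p := by injection h
    filter_upwards [hO.mem_nhds hq] with q' hq'
    exact ⟨q', hq', rfl⟩
  · rw [tube, plane_mem_image] at hpW
    obtain ⟨h1, h2, h3⟩ := hpW
    filter_upwards [hfst.abs.continuousAt.eventually_lt_const h1,
      (hg x).eventually_lt hsnd.continuousAt h2, hsnd.continuousAt.eventually_lt (hg y) h3]
      with q e1 e2 e3
    rw [tube, plane_mem_image]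
    exact ⟨e1, e2, e3⟩
  · rw [endNhd, plane_mem_image] at hpW
    obtain ⟨h1, h2, h3⟩ := hpW
    filter_upwards [hfst.abs.continuousAt.eventually_lt_const h1,
      hsnd.continuousAt.eventually_const_lt h2, hsnd.continuousAt.eventually_lt (hg _) h3]
      with q e1 e2 e3
    rw [endNhd, plane_mem_image]
    exact ⟨e1, e2, e3⟩

end Nyikos

/-- The open quadrant `{(s, t) | 0 < s, t < 0}`. -/
abbrev Quadrant : Type := {p : ℝ × ℝ // 0 < p.1 ∧ p.2 < 0}

namespace Quadrant

theorem ne_zero (p : Quadrant) : p.1 ≠ (0, 0) := fun h => by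
  have := p.2.1
  rw [h] at this
  exact lt_irrefl _ this

/-- The inclusion of the quadrant in the cut surface. -/
def toCut (f : Ordinal.{0} → ℕ → ℕ) (p : Quadrant) : cutQuadrant f :=
  ⟨.plane ⟨p.1, p.ne_zero⟩, Or.inl ⟨_, p.2, rfl⟩⟩

variable {f : Ordinal.{0} → ℕ → ℕ}

theorem toCut_injective : Function.Injective (toCut f) := by
  intro p q h
  have h : Nyikos.plane (f := f) ⟨p.1, p.ne_zero⟩ = .plane ⟨q.1, q.ne_zero⟩ :=
    congrArg Subtype.val h
  injection h with h
  exact Subtype.ext (congrArg (fun x : {p : ℝ × ℝ // p ≠ (0, 0)} => x.1) h)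

theorem continuous_toCut (hf : IsNyikosSeq f) : Continuous (toCut f) := by
  refine continuous_induced_rng.2 (Nyikos.continuous_of_generators fun W hW p hp => ?_)
  have hc : Continuous fun p : Quadrant => (⟨p.1, p.ne_zero⟩ : {p : ℝ × ℝ // p ≠ (0, 0)}) := by
    fun_prop
  exact hc.continuousAt.eventually (Nyikos.eventually_plane_mem hf hW p.2.1 hp)

theorem isOpenMap_toCut : IsOpenMap (toCut f) := by
  intro O hO
  obtain ⟨O', hO', rfl⟩ := isOpen_induced_iff.1 hO
  refine ⟨_, Nyikos.isOpen_plane_image (O := {p | p.1 ∈ O' ∧ 0 < p.1.1 ∧ p.1.2 < 0}) ?_, ?_⟩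
  · refine (hO'.preimage continuous_subtype_val).inter (IsOpen.inter ?_ ?_)
    · exact isOpen_lt continuous_const (continuous_fst.comp continuous_subtype_val)
    · exact isOpen_lt (continuous_snd.comp continuous_subtype_val) continuous_const
  · ext ⟨x, hx⟩
    constructor
    · rintro ⟨p, ⟨h1, h2⟩, rfl⟩
      exact ⟨⟨p.1, h2⟩, h1, rfl⟩
    · rintro ⟨p, h1, h2⟩
      exact ⟨⟨p.1, p.ne_zero⟩, ⟨h1, p.2⟩, congrArg Subtype.val h2⟩

end Quadrant

/-! ### The boundary strips of the cut surface -/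

/-- A half-strip in the closed upper half plane. -/
abbrev HalfStrip : Type := {z : ℂ // 0 ≤ z.im ∧ |z.re| < 1 / 2}

namespace HalfStrip

theorem re_mem (z : HalfStrip) : z.1.re + 1 / 2 ∈ Set.Ioo (0 : ℝ) 1 := by
  have := abs_lt.1 z.2.2
  constructor <;> linarith

theorem mem_nhds_iff {z : HalfStrip} {S : Set HalfStrip} (hS : S ∈ 𝓝 z) :
    ∃ ε > 0, ∀ w : HalfStrip, |w.1.re - z.1.re| < ε → |w.1.im - z.1.im| < ε → w ∈ S := by
  obtain ⟨ε, hε, h⟩ := Metric.mem_nhds_iff.1 hS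
  refine ⟨ε / 2, half_pos hε, fun w h1 h2 => h ?_⟩
  rw [Metric.mem_ball, Subtype.dist_eq, dist_eq_norm]
  refine (Complex.norm_le_abs_re_add_abs_im _).trans_lt ?_
  rw [Complex.sub_re, Complex.sub_im]
  linarith

variable {f : Ordinal.{0} → ℕ → ℕ}

open Classical in
/-- The parametrization of a neighbourhood of `(α, α + 1)` in the cut surface. -/
def toCut (hf : IsNyikosSeq f) (α : Set.Iio (ω₁ : Ordinal.{0})) (z : HalfStrip) : cutQuadrant f :=
  -- The shift by `1/2` centres the interval, so that the identification of `r` with `1 - r` becomes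
  -- `z ↦ -z` on the boundary line, exactly the identification made there by squaring.
  if h : z.1.im = 0 then
    ⟨.ray (.mk α (z.1.re + 1 / 2) z.re_mem.1.le z.re_mem.2), Or.inr ⟨_, z.re_mem.1.ne', rfl⟩⟩
  else
    Quadrant.toCut f ⟨(z.1.im, stripHeight (f α) (z.1.re + 1 / 2) z.1.im),
      lt_of_le_of_ne z.2.1 (Ne.symm h),
      stripHeight_neg (hf.strictMono α α.2) (lt_of_le_of_ne z.2.1 (Ne.symm h)) z.re_mem.1.le⟩

variable (hf : IsNyikosSeq f) (α : Set.Iio (ω₁ : Ordinal.{0}))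

theorem toCut_of_im_eq {z : HalfStrip} (h : z.1.im = 0) :
    (toCut hf α z).1 = .ray (.mk α (z.1.re + 1 / 2) z.re_mem.1.le z.re_mem.2) := by
  rw [toCut, dif_pos h]

/-- The point of the quadrant with strip coordinates `z`. -/
def toQuadrant (z : HalfStrip) (h : 0 < z.1.im) : Quadrant :=
  ⟨(z.1.im, stripHeight (f α) (z.1.re + 1 / 2) z.1.im), h,
    stripHeight_neg (hf.strictMono α α.2) h z.re_mem.1.le⟩

theorem toCut_of_im_pos {z : HalfStrip} (h : 0 < z.1.im) :
    toCut hf α z = Quadrant.toCut f (toQuadrant hf α z h) := by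
  rw [toCut, dif_neg h.ne']
  rfl

theorem toCut_injective : Function.Injective (toCut hf α) := by
  intro z w h
  rcases z.2.1.eq_or_lt with hz | hz <;> rcases w.2.1.eq_or_lt with hw | hw
  · have h := congrArg Subtype.val h
    rw [toCut_of_im_eq hf α hz.symm, toCut_of_im_eq hf α hw.symm] at h
    injection h with h
    have := congrArg LongRay.frac h
    simp only [LongRay.frac_mk] at this
    exact Subtype.ext (Complex.ext (by linarith) (hz.symm.trans hw))
  · have h := congrArg Subtype.val h
    rw [toCut_of_im_eq hf α hz.symm, toCut_of_im_pos hf α hw] at h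
    simp [Quadrant.toCut] at h
  · have h := congrArg Subtype.val h
    rw [toCut_of_im_eq hf α hw.symm, toCut_of_im_pos hf α hz] at h
    simp [Quadrant.toCut] at h
  · rw [toCut_of_im_pos hf α hz, toCut_of_im_pos hf α hw] at h
    have h := congrArg Subtype.val (Quadrant.toCut_injective h)
    simp only [toQuadrant, Prod.mk.injEq] at h
    obtain ⟨h1, h2⟩ := h
    rw [h1] at h2
    have mono : StrictMonoOn (fun r => stripHeight (f α) r w.1.im) (Set.Ici 0) :=
      fun r hr r' _ hrr => stripHeight_strictMono (hf.strictMono α α.2) hw hr hrr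
    have := mono.injOn z.re_mem.1.le w.re_mem.1.le h2
    exact Subtype.ext (Complex.ext (by linarith) h1)

theorem continuousAt_stripHeight (hf : IsNyikosSeq f) (α : Set.Iio (ω₁ : Ordinal.{0})) {z : HalfStrip} (h : 0 < z.1.im) :
    ContinuousAt (fun w : HalfStrip => stripHeight (f α) (w.1.re + 1 / 2) w.1.im) z := by
  have h1 : ContinuousAt (fun p : ℝ × ℝ => stripHeight (f α) p.1 p.2) (z.1.re + 1 / 2, z.1.im) := by
    refine (continuousOn_stripHeight (hf.strictMono α α.2)).continuousAt ?_
    have : {p : ℝ × ℝ | 0 < p.1 ∧ 0 < p.2} ∈ 𝓝 (z.1.re + 1 / 2, z.1.im) :=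
      ((isOpen_lt continuous_const continuous_fst).inter
        (isOpen_lt continuous_const continuous_snd)).mem_nhds ⟨z.re_mem.1, h⟩
    filter_upwards [this] with p hp using ⟨hp.1.le, hp.2⟩
  have h2 : Continuous fun w : HalfStrip => (w.1.re + 1 / 2, w.1.im) := by fun_prop
  exact ContinuousAt.comp (f := fun w : HalfStrip => (w.1.re + 1 / 2, w.1.im)) h1 h2.continuousAt

/-- Above the boundary the map is a continuous planar formula. At a boundary point the generators
are tested one by one: each contains, near `s = 0`, the region between two curves of the strip `α`,
or below one such curve and above `-ε`. -/
theorem continuous_toCut : Continuous (toCut hf α) := by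
  refine continuous_iff_continuousAt.2 fun z => ?_
  have cre : Continuous fun w : HalfStrip => w.1.re := by fun_prop
  have cim : Continuous fun w : HalfStrip => w.1.im := by fun_prop
  rcases z.2.1.eq_or_lt with hz | hz
  swap
  · have hpos : ∀ᶠ w : HalfStrip in 𝓝 z, 0 < w.1.im :=
      cim.continuousAt.eventually_const_lt hz
    let U : Set HalfStrip := {w | 0 < w.1.im}
    have hU : IsOpen U := isOpen_lt continuous_const cim
    have c : Continuous fun w : U => toQuadrant hf α w.1 w.2 := by
      refine Continuous.subtype_mk (Continuous.prodMk (by fun_prop) ?_) _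
      refine continuous_iff_continuousAt.2 fun w => ?_
      exact (continuousAt_stripHeight hf α w.2).comp (f := (Subtype.val : U → HalfStrip))
        continuous_subtype_val.continuousAt
    have c' : ContinuousOn (toCut hf α) U := by
      rw [continuousOn_iff_continuous_domRestrict]
      convert (Quadrant.continuous_toCut hf).comp c using 1
      ext1 w
      exact toCut_of_im_pos hf α w.2
    exact c'.continuousAt (hU.mem_nhds hz)
  rw [Topology.IsInducing.subtypeVal.continuousAt_iff, ContinuousAt,
    TopologicalSpace.tendsto_nhds_generateFrom_iff]
  intro W hW hzW
  change W ∈ Nyikos.generators f at hW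
  simp only [Function.comp_apply, toCut_of_im_eq hf α hz.symm] at hzW
  change ∀ᶠ w in 𝓝 z, (toCut hf α w).1 ∈ W
  have key : (∀ᶠ w : HalfStrip in 𝓝 z,
      (w.1.im = 0 → (.ray (.mk α (w.1.re + 1 / 2) w.re_mem.1.le w.re_mem.2) : Nyikos f) ∈ W) ∧
      ∀ h : 0 < w.1.im, (.plane ⟨_, (toQuadrant hf α w h).ne_zero⟩ : Nyikos f) ∈ W) →
      ∀ᶠ w in 𝓝 z, (toCut hf α w).1 ∈ W := by
    intro h
    filter_upwards [h] with w hw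
    rcases w.2.1.eq_or_lt with h0 | h0
    · rw [toCut_of_im_eq hf α h0.symm]; exact hw.1 h0.symm
    · rw [toCut_of_im_pos hf α h0]; exact hw.2 h0
  apply key
  -- The upper bound by a point of the ray occurs both in the sets `tube` and in the sets `endNhd`.
  have upper : ∀ y : LongRay, LongRay.mk α (z.1.re + 1 / 2) z.re_mem.1.le z.re_mem.2 < y →
      ∀ᶠ w : HalfStrip in 𝓝 z, LongRay.mk α (w.1.re + 1 / 2) w.re_mem.1.le w.re_mem.2 < y ∧
        (0 < w.1.im → stripHeight (f α) (w.1.re + 1 / 2) w.1.im < nyikosG f y w.1.im) := by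
    intro y hy
    obtain ⟨r, h1, h2, h3⟩ := LongRay.exists_between_right hy
    simp only [LongRay.frac_mk, LongRay.ord_mk] at h1 h3
    have hr : 0 ≤ r := z.re_mem.1.le.trans h1.le
    obtain ⟨δ, hδ, H⟩ := exists_nyikosG_lt_right hf hr h2 h3
    have e1 : ∀ᶠ w : HalfStrip in 𝓝 z, w.1.re + 1 / 2 < r :=
      (cre.add continuous_const).continuousAt.eventually_lt_const h1
    have e2 : ∀ᶠ w : HalfStrip in 𝓝 z, w.1.im < δ :=
      cim.continuousAt.eventually_lt_const (by simpa [← hz] using hδ)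
    filter_upwards [e1, e2] with w w1 w2
    refine ⟨LongRay.lt_iff.2 ?_, fun hw => ?_⟩
    · rcases h3 with h3 | ⟨h3, h4⟩
      · exact Or.inl h3
      · exact Or.inr ⟨h3, w1.trans h4⟩
    · exact (stripHeight_strictMono (hf.strictMono α α.2) hw w.re_mem.1.le w1).trans (H _ hw w2)
  have small : ∀ ε : ℝ, 0 < ε → ∀ᶠ w : HalfStrip in 𝓝 z, |w.1.im| < ε := fun ε hε =>
    cim.abs.continuousAt.eventually_lt_const (by simpa [← hz] using hε)
  rcases hW with (⟨O, hO, rfl⟩ | ⟨ε, x, y, hε, hx, hxy, rfl⟩) | ⟨ε, hε, rfl⟩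
  · simp at hzW
  · rw [Nyikos.tube, Nyikos.ray_mem_image] at hzW
    obtain ⟨r, h1, h2, h3⟩ := LongRay.exists_between_left (by exact z.re_mem.1) hzW.1
    simp only [LongRay.frac_mk, LongRay.ord_mk] at h2 h3
    obtain ⟨δ, hδ, H⟩ := exists_nyikosG_lt_left hf α.2 h1.le h3
    have e1 : ∀ᶠ w : HalfStrip in 𝓝 z, r < w.1.re + 1 / 2 :=
      (cre.add continuous_const).continuousAt.eventually_const_lt h2
    filter_upwards [e1, small δ hδ, small ε hε, upper y hzW.2] with w w1 w2 w3 w4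
    simp only [Nyikos.tube, Nyikos.ray_mem_image, Nyikos.plane_mem_image]
    refine ⟨fun _ => ⟨LongRay.lt_iff.2 ?_, w4.1⟩, fun hw => ⟨w3, ?_, w4.2 hw⟩⟩
    · rcases h3 with h3 | ⟨h3, h4⟩
      · exact Or.inl h3
      · exact Or.inr ⟨h3, h4.trans w1⟩
    · exact (H _ hw (abs_lt.1 w2).2).trans
        (stripHeight_strictMono (hf.strictMono α α.2) hw h1.le w1)
  · rw [Nyikos.endNhd, Nyikos.ray_mem_image] at hzW
    obtain ⟨δ, hδ, H⟩ := exists_neg_lt_stripHeight hε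
    filter_upwards [small δ hδ, small ε hε, upper _ hzW] with w w2 w3 w4
    simp only [Nyikos.endNhd, Nyikos.ray_mem_image, Nyikos.plane_mem_image]
    exact ⟨fun _ => w4.1, fun hw => ⟨w3, H _ (hf.strictMono α α.2) _ _ w.re_mem.1.le hw
      (abs_lt.1 w2).2, w4.2 hw⟩⟩

/-- The part of the strip between two curves is covered by the parametrization. -/
theorem exists_toCut_eq {r₁ r₂ : ℝ} (h0 : 0 ≤ r₁) (h : r₁ ≤ r₂) (h1 : r₂ ≤ 1) {p : Quadrant}
    (hp1 : stripHeight (f α) r₁ p.1.1 < p.1.2) (hp2 : p.1.2 < stripHeight (f α) r₂ p.1.1) :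
    ∃ z : HalfStrip, z.1.im = p.1.1 ∧ r₁ < z.1.re + 1 / 2 ∧ z.1.re + 1 / 2 < r₂ ∧
      toCut hf α z = Quadrant.toCut f p := by
  obtain ⟨r, hr, hrt⟩ := exists_stripHeight_eq (hf.strictMono α α.2) p.2.1 h0 h hp1 hp2
  refine ⟨⟨⟨r - 1 / 2, p.1.1⟩, p.2.1.le, ?_⟩, rfl, ?_, ?_, ?_⟩
  · rw [abs_lt]
    constructor <;> linarith [hr.1, hr.2]
  · simpa using hr.1
  · simpa using hr.2
  · rw [toCut_of_im_pos hf α p.2.1]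
    congr 1
    refine Subtype.ext (Prod.ext rfl ?_)
    simp only [toQuadrant]
    rw [← hrt]
    congr 1
    ring

/-- By the intermediate value theorem, a small rectangle in strip coordinates fills everything
between its two extreme curves. Together with its boundary interval this is the trace of a `tube`.
Away from the boundary it is an open region of the quadrant. -/
theorem isOpenMap_toCut : IsOpenMap (toCut hf α) := by
  refine IsOpenMap.of_nhds_le fun z S hS => ?_
  obtain ⟨ε, hε, h⟩ := mem_nhds_iff (mem_map.1 hS)
  obtain ⟨r₁, h11, h12⟩ := exists_between (max_lt z.re_mem.1
    (by linarith : z.1.re + 1 / 2 - ε < z.1.re + 1 / 2))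
  obtain ⟨r₂, h21, h22⟩ := exists_between (lt_min z.re_mem.2
    (by linarith : z.1.re + 1 / 2 < z.1.re + 1 / 2 + ε))
  rw [max_lt_iff] at h11
  rw [lt_min_iff] at h22
  have hmem : ∀ w : HalfStrip, r₁ < w.1.re + 1 / 2 → w.1.re + 1 / 2 < r₂ →
      |w.1.im - z.1.im| < ε → toCut hf α w ∈ S := by
    intro w h1 h2 h3
    exact h w (by rw [abs_lt]; constructor <;> linarith) h3
  rcases z.2.1.eq_or_lt with hz | hz
  · have hxy : LongRay.mk α r₁ h11.1.le (by linarith) < LongRay.mk α r₂ (by linarith) h22.1 :=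
      LongRay.lt_iff.2 (Or.inr ⟨rfl, by simp only [LongRay.frac_mk]; linarith⟩)
    have hopen := Nyikos.isOpen_tube (f := f) hε
      (LongRay.zero_lt_of_frac_pos (x := LongRay.mk α r₁ h11.1.le (by linarith)) h11.1) hxy
    refine mem_of_superset ((hopen.preimage continuous_subtype_val).mem_nhds ?_) ?_
    · rw [Set.mem_preimage, toCut_of_im_eq hf α hz.symm, Nyikos.tube, Nyikos.ray_mem_image]
      exact ⟨LongRay.lt_iff.2 (Or.inr ⟨rfl, h12⟩), LongRay.lt_iff.2 (Or.inr ⟨rfl, h21⟩)⟩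
    · rintro ⟨x, (⟨p, hp, rfl⟩ | ⟨x, hx, rfl⟩)⟩ hmemx
      · rw [Set.mem_preimage, Nyikos.tube, Nyikos.plane_mem_image] at hmemx
        obtain ⟨w, hw1, hw2, hw3, hw4⟩ := exists_toCut_eq hf α h11.1.le (by linarith) h22.1.le
          (p := ⟨p.1, hp⟩) hmemx.2.1 hmemx.2.2
        have := hmem w hw2 hw3 (by rw [← hz, hw1, sub_zero]; exact hmemx.1)
        rwa [hw4] at this
      · rw [Set.mem_preimage, Nyikos.tube, Nyikos.ray_mem_image] at hmemx
        -- A point between `α + r₁` and `α + r₂` cannot leave the unit interval of `α`.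
        have ho : x.ord = α := by
          have h1 := LongRay.lt_iff.1 hmemx.1
          have h2 := LongRay.lt_iff.1 hmemx.2
          simp only [LongRay.ord_mk] at h1 h2
          rcases h1 with h1 | h1
          · rcases h2 with h2 | h2
            · exact absurd h1 h2.not_gt
            · exact h2.1
          · exact h1.1.symm
        have hx1 : r₁ < x.frac := by
          have := LongRay.lt_iff.1 hmemx.1
          simpa [ho] using this
        have hx2 : x.frac < r₂ := by
          have := LongRay.lt_iff.1 hmemx.2
          simpa [ho] using this
        let w : HalfStrip := ⟨⟨x.frac - 1 / 2, 0⟩, le_rfl, by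
          rw [abs_lt]; constructor <;> simp only <;> linarith⟩
        have hw : w.1.re + 1 / 2 = x.frac := by simp [w]
        have := hmem w (by rw [hw]; exact hx1) (by rw [hw]; exact hx2)
          (by rw [← hz]; simpa [w] using hε)
        convert this
        refine Subtype.ext ?_
        rw [toCut_of_im_eq hf α (z := w) rfl]
        exact congrArg Nyikos.ray (LongRay.ext_ord_frac ho hw.symm)
  · let O : Set Quadrant := {p | |p.1.1 - z.1.im| < ε ∧ stripHeight (f α) r₁ p.1.1 < p.1.2 ∧
      p.1.2 < stripHeight (f α) r₂ p.1.1}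
    have cs : ∀ r : ℝ, 0 ≤ r → Continuous fun p : Quadrant => stripHeight (f α) r p.1.1 := by
      intro r hr
      exact (continuousOn_stripHeight (hf.strictMono α α.2)).comp_continuous
        (f := fun p : Quadrant => (r, p.1.1)) (by fun_prop) fun p => ⟨hr, p.2.1⟩
    have hO : IsOpen O := by
      have c1 : Continuous fun p : Quadrant => |p.1.1 - z.1.im| := by fun_prop
      refine IsOpen.inter (isOpen_lt c1 continuous_const)
        (IsOpen.inter (isOpen_lt (cs _ h11.1.le) (by fun_prop))
          (isOpen_lt (by fun_prop) (cs _ (by linarith))))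
    refine mem_of_superset ((Quadrant.isOpenMap_toCut O hO).mem_nhds ?_) ?_
    · rw [toCut_of_im_pos hf α hz]
      refine ⟨_, ⟨?_, ?_, ?_⟩, rfl⟩
      · simpa [toQuadrant] using hε
      · exact stripHeight_strictMono (hf.strictMono α α.2) hz h11.1.le h12
      · exact stripHeight_strictMono (hf.strictMono α α.2) hz z.re_mem.1.le h21
    · rintro _ ⟨p, hp, rfl⟩
      obtain ⟨w, hw1, hw2, hw3, hw4⟩ := exists_toCut_eq hf α h11.1.le (by linarith) h22.1.le
        hp.2.1 hp.2.2
      rw [← hw4]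
      exact hmem w hw2 hw3 (by rw [hw1]; exact hp.1)

end HalfStrip

/-! ### Folding -/

/-- The image of the half-strip under squaring: the interior of a parabola. -/
abbrev ParabolaRegion : Type := {w : ℂ // ‖w‖ + w.re < 1 / 2}

/-- This identity turns `|Re z| < 1/2` into the condition defining `ParabolaRegion`. Its companion
for the difference recovers the width `Im z` from `z ^ 2`. -/
theorem norm_sq_add_re_sq (z : ℂ) : ‖z ^ 2‖ + (z ^ 2).re = 2 * z.re ^ 2 := by
  rw [norm_pow, ← Complex.normSq_eq_norm_sq, Complex.normSq_apply, sq z, Complex.mul_re]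
  ring

theorem norm_sq_sub_re_sq (z : ℂ) : ‖z ^ 2‖ - (z ^ 2).re = 2 * z.im ^ 2 := by
  rw [norm_pow, ← Complex.normSq_eq_norm_sq, Complex.normSq_apply, sq z, Complex.mul_re]
  ring

namespace HalfStrip

/-- Folding the half-strip along its boundary. -/
def fold (z : HalfStrip) : ParabolaRegion := ⟨z.1 ^ 2, by
  rw [norm_sq_add_re_sq]
  have := abs_lt.1 z.2.2
  nlinarith⟩

theorem continuous_fold : Continuous fold := by
  unfold fold
  fun_prop

theorem fold_surjective : Function.Surjective fold := by
  rintro ⟨w, hw⟩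
  obtain ⟨z, rfl⟩ := IsAlgClosed.exists_pow_nat_eq w two_pos
  have key : ∀ z : ℂ, ‖z ^ 2‖ + (z ^ 2).re < 1 / 2 → |z.re| < 1 / 2 := by
    intro z hz
    rw [norm_sq_add_re_sq] at hz
    exact abs_lt_of_sq_lt_sq (by linarith) (by norm_num)
  rcases le_total 0 z.im with h | h
  · exact ⟨⟨z, h, key z hw⟩, rfl⟩
  · refine ⟨⟨-z, by simpa using h, ?_⟩, Subtype.ext (neg_sq z)⟩
    rw [Complex.neg_re, abs_neg]
    exact key z hw

theorem fold_eq_fold_iff {z w : HalfStrip} : fold z = fold w ↔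
    z = w ∨ z.1.im = 0 ∧ w.1.im = 0 ∧ z.1.re + w.1.re = 0 := by
  rw [Subtype.ext_iff]
  change z.1 ^ 2 = w.1 ^ 2 ↔ _
  rw [sq_eq_sq_iff_eq_or_eq_neg, Subtype.ext_iff]
  refine or_congr_right' fun _ => ⟨fun h => ?_, fun h => ?_⟩
  · have h1 := congrArg Complex.im h
    have h2 := congrArg Complex.re h
    rw [Complex.neg_im] at h1
    rw [Complex.neg_re] at h2
    have := z.2.1
    have := w.2.1
    exact ⟨by linarith, by linarith, by linarith⟩
  · refine Complex.ext ?_ ?_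
    · rw [Complex.neg_re]; linarith
    · rw [Complex.neg_im]; linarith

theorem isClosedMap_sq : IsClosedMap fun z : ℂ => z ^ 2 := by
  refine IsProperMap.isClosedMap (isProperMap_iff_tendsto_cocompact.2 ⟨by fun_prop, ?_⟩)
  rw [← Metric.cobounded_eq_cocompact, ← tendsto_norm_atTop_iff_cobounded,
    Metric.cobounded_eq_cocompact]
  simp only [norm_pow]
  exact (tendsto_pow_atTop two_ne_zero).comp (tendsto_norm_cocompact_atTop (E := ℂ))

/-- Squaring is proper, hence closed. A closed set of the half-strip is the trace of one that is
closed in `ℂ` and lies in the upper half-plane. The condition on the real part, which is not closed,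
need not be imposed beforehand: it can be read off from the square. -/
theorem isQuotientMap_fold : IsQuotientMap fold := by
  refine IsClosedMap.isQuotientMap (fun C hC => ?_) continuous_fold fold_surjective
  obtain ⟨D, hD, rfl⟩ := isClosed_induced_iff.1 hC
  have h1 : IsClosed (D ∩ {z : ℂ | 0 ≤ z.im}) :=
    hD.inter (isClosed_le continuous_const Complex.continuous_im)
  convert (isClosedMap_sq _ h1).preimage (continuous_subtype_val (p := fun w : ℂ => ‖w‖ + w.re < 1 / 2))
  ext w
  constructor
  · rintro ⟨z, hz, rfl⟩
    exact ⟨z.1, ⟨hz, z.2.1⟩, rfl⟩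
  · rintro ⟨z, ⟨hz, hz0⟩, hzw⟩
    have hw := w.2
    rw [← hzw] at hw
    simp only [norm_sq_add_re_sq] at hw
    exact ⟨⟨z, hz0, abs_lt_of_sq_lt_sq (by linarith) (by norm_num)⟩, hz, Subtype.ext hzw⟩

end HalfStrip

/-! ### Open embeddings into the folded surface -/

namespace MoorizedNyikos

variable {f : Ordinal.{0} → ℕ → ℕ}

/-- The projection of the cut surface. -/
def proj (p : cutQuadrant f) : MoorizedNyikos f := Quotient.mk (moorization f) p

theorem isQuotientMap_proj : IsQuotientMap (proj : cutQuadrant f → MoorizedNyikos f) :=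
  isQuotientMap_quot_mk

theorem proj_eq_proj_iff {p q : cutQuadrant f} : proj p = proj q ↔
    p = q ∨ ∃ x y : LongRay, p.1 = Nyikos.ray x ∧ q.1 = Nyikos.ray y ∧
      x.ord = y.ord ∧ x.frac + y.frac = 1 :=
  Quotient.eq (r := moorization f)

/-- The inclusion of the quadrant. -/
def ofQuadrant (f : Ordinal.{0} → ℕ → ℕ) (p : Quadrant) : MoorizedNyikos f := proj (p.toCut f)

theorem proj_eq_ofQuadrant_iff {p : cutQuadrant f} {q : Quadrant} :
    proj p = ofQuadrant f q ↔ p = q.toCut f := by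
  rw [ofQuadrant, proj_eq_proj_iff]
  refine ⟨?_, Or.inl⟩
  rintro (h | ⟨x, y, -, h, -⟩)
  · exact h
  · exact absurd h (by simp [Quadrant.toCut])

theorem ofQuadrant_injective : Function.Injective (ofQuadrant f) := fun _ _ h =>
  Quadrant.toCut_injective (proj_eq_ofQuadrant_iff.1 h)

theorem isOpenEmbedding_ofQuadrant (hf : IsNyikosSeq f) : IsOpenEmbedding (ofQuadrant f) := by
  refine .of_continuous_injective_isOpenMap
    (isQuotientMap_proj.continuous.comp (Quadrant.continuous_toCut hf)) ofQuadrant_injective ?_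
  intro O hO
  rw [← isQuotientMap_proj.isOpen_preimage]
  convert Quadrant.isOpenMap_toCut O hO using 1
  ext p
  constructor
  · rintro ⟨q, hq, h⟩
    exact ⟨q, hq, (proj_eq_ofQuadrant_iff.1 h.symm).symm⟩
  · rintro ⟨q, hq, rfl⟩
    exact ⟨q, hq, rfl⟩

variable (hf : IsNyikosSeq f) (α β : Set.Iio (ω₁ : Ordinal.{0}))

/-- Moorization on the strip is the relation of having the same square. Therefore the
parametrization descends along `fold` injectively, and images of open sets have the expected
preimages under `proj`. -/
theorem proj_toCut_eq_iff {z : HalfStrip} {p : cutQuadrant f} :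
    proj p = proj (z.toCut hf α) ↔ ∃ w : HalfStrip, w.fold = z.fold ∧ p = w.toCut hf α := by
  constructor
  · intro h
    rcases proj_eq_proj_iff.1 h with rfl | ⟨x, y, hx, hy, ho, hs⟩
    · exact ⟨z, rfl, rfl⟩
    · have hz : z.1.im = 0 := by
        by_contra hne
        rw [HalfStrip.toCut_of_im_pos hf α (lt_of_le_of_ne z.2.1 (Ne.symm hne))] at hy
        simp [Quadrant.toCut] at hy
      rw [HalfStrip.toCut_of_im_eq hf α hz] at hy
      obtain rfl : _ = y := by injection hy
      simp only [LongRay.ord_mk, LongRay.frac_mk] at ho hs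
      let w : HalfStrip := ⟨⟨-z.1.re, 0⟩, le_rfl, by simpa using z.2.2⟩
      refine ⟨w, HalfStrip.fold_eq_fold_iff.2 (Or.inr ⟨rfl, hz, by simp [w]⟩), Subtype.ext ?_⟩
      rw [hx, HalfStrip.toCut_of_im_eq hf α (z := w) rfl]
      refine congrArg Nyikos.ray (LongRay.ext_ord_frac ho ?_)
      simp only [LongRay.frac_mk, w]
      linarith
  · rintro ⟨w, hw, rfl⟩
    rcases HalfStrip.fold_eq_fold_iff.1 hw with rfl | ⟨hw0, hz0, hs⟩
    · rfl
    · refine proj_eq_proj_iff.2 (Or.inr ⟨_, _, HalfStrip.toCut_of_im_eq hf α hw0,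
        HalfStrip.toCut_of_im_eq hf α hz0, rfl, ?_⟩)
      simp only [LongRay.frac_mk]
      linarith

/-- The parametrization of a neighbourhood of the folded interval `(α, α + 1)`. -/
def ofParabola : C(ParabolaRegion, MoorizedNyikos f) :=
  IsQuotientMap.lift (f := ⟨_, HalfStrip.continuous_fold⟩) HalfStrip.isQuotientMap_fold
    ⟨fun z => proj (z.toCut hf α), isQuotientMap_proj.continuous.comp
      (HalfStrip.continuous_toCut hf α)⟩
    fun z _ h => (proj_toCut_eq_iff hf α).2 ⟨z, h, rfl⟩

theorem ofParabola_fold (z : HalfStrip) : ofParabola hf α z.fold = proj (z.toCut hf α) :=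
  DFunLike.congr_fun (IsQuotientMap.lift_comp (f := ⟨_, HalfStrip.continuous_fold⟩)
    HalfStrip.isQuotientMap_fold ⟨fun z => proj (z.toCut hf α), isQuotientMap_proj.continuous.comp
      (HalfStrip.continuous_toCut hf α)⟩
    fun z _ h => (proj_toCut_eq_iff hf α).2 ⟨z, h, rfl⟩) z

theorem ofParabola_fold_of_im_pos {z : HalfStrip} (h : 0 < z.1.im) :
    ofParabola hf α z.fold = ofQuadrant f (z.toQuadrant hf α h) := by
  rw [ofParabola_fold, HalfStrip.toCut_of_im_pos hf α h]
  rfl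

theorem ofParabola_injective : Function.Injective (ofParabola hf α) := by
  intro v w h
  obtain ⟨v, rfl⟩ := HalfStrip.fold_surjective v
  obtain ⟨w, rfl⟩ := HalfStrip.fold_surjective w
  rw [ofParabola_fold, ofParabola_fold, proj_toCut_eq_iff] at h
  obtain ⟨w', h1, h2⟩ := h
  rw [HalfStrip.toCut_injective hf α h2, h1]

theorem isOpenEmbedding_ofParabola : IsOpenEmbedding (ofParabola hf α) := by
  refine .of_continuous_injective_isOpenMap (ofParabola hf α).continuous
    (ofParabola_injective hf α) fun O hO => ?_
  rw [← isQuotientMap_proj.isOpen_preimage]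
  convert HalfStrip.isOpenMap_toCut hf α _ (hO.preimage HalfStrip.continuous_fold) using 1
  ext p
  constructor
  · rintro ⟨w, hw, h⟩
    obtain ⟨z, rfl⟩ := HalfStrip.fold_surjective w
    rw [ofParabola_fold] at h
    obtain ⟨w, h1, rfl⟩ := (proj_toCut_eq_iff hf α).1 h.symm
    exact ⟨w, by rwa [Set.mem_preimage, h1], rfl⟩
  · rintro ⟨z, hz, rfl⟩
    exact ⟨z.fold, hz, ofParabola_fold hf α z⟩

/-! ### Width and planar coordinates on the folded surface. -/

/-- The first coordinate, extended by `0` to the folded intervals. -/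
def width : MoorizedNyikos f → ℝ :=
  Quotient.lift (fun p : cutQuadrant f => match p.1 with
    | .plane p => p.1.1
    | .ray _ => 0) (by
      rintro p q (rfl | ⟨x, y, hx, hy, -⟩)
      · rfl
      · simp only [hx, hy])

/-- The coordinates of the points of the quadrant. -/
def coord : MoorizedNyikos f → ℝ × ℝ :=
  Quotient.lift (fun p : cutQuadrant f => match p.1 with
    | .plane p => p.1
    | .ray _ => 0) (by
      rintro p q (rfl | ⟨x, y, hx, hy, -⟩)
      · rfl
      · simp only [hx, hy])

@[simp] theorem width_ofQuadrant (p : Quadrant) : width (ofQuadrant f p) = p.1.1 := rfl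

@[simp] theorem coord_ofQuadrant (p : Quadrant) : coord (ofQuadrant f p) = p.1 := rfl

theorem width_ofParabola_fold (z : HalfStrip) : width (ofParabola hf α z.fold) = z.1.im := by
  rcases z.2.1.eq_or_lt with h | h
  · rw [ofParabola_fold, ← h]
    change (match (z.toCut hf α).1 with
    | .plane p => p.1.1
    | .ray _ => 0) = _
    rw [HalfStrip.toCut_of_im_eq hf α h.symm]
  · rw [ofParabola_fold_of_im_pos hf α h]
    rfl

/-- Every point lies in the quadrant or on a folded interval. -/
theorem exists_rep (m : MoorizedNyikos f) : (∃ p, m = ofQuadrant f p) ∨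
    ∃ (α : Set.Iio (ω₁ : Ordinal.{0})) (z : HalfStrip), z.1.im = 0 ∧ m = ofParabola hf α z.fold := by
  obtain ⟨p, rfl⟩ := isQuotientMap_proj.surjective m
  obtain ⟨p, ⟨q, hq, rfl⟩ | ⟨x, hx, rfl⟩⟩ := p
  · exact Or.inl ⟨⟨q.1, hq⟩, rfl⟩
  · have h0 : 0 < x.frac := lt_of_le_of_ne x.frac_nonneg (Ne.symm hx)
    let z : HalfStrip := ⟨⟨x.frac - 1 / 2, 0⟩, le_rfl, by
      have := x.frac_lt_one
      rw [abs_lt]; constructor <;> simp only <;> linarith⟩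
    refine Or.inr ⟨⟨x.ord, x.ord_lt⟩, z, rfl, ?_⟩
    rw [ofParabola_fold]
    refine congrArg proj (Subtype.ext ?_)
    rw [HalfStrip.toCut_of_im_eq hf _ (z := z) rfl]
    exact congrArg Nyikos.ray (LongRay.ext_ord_frac rfl (by simp [z]))

theorem continuous_width (hf : IsNyikosSeq f) : Continuous (width : MoorizedNyikos f → ℝ) := by
  refine continuous_iff_continuousAt.2 fun m => ?_
  rcases exists_rep hf m with ⟨p, rfl⟩ | ⟨α, z, -, rfl⟩
  · rw [← (isOpenEmbedding_ofQuadrant hf).continuousAt_iff]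
    exact (continuous_fst.comp continuous_subtype_val).continuousAt
  · rw [← (isOpenEmbedding_ofParabola hf α).continuousAt_iff]
    refine Continuous.continuousAt (HalfStrip.isQuotientMap_fold.continuous_iff.2 ?_)
    have : (width ∘ ofParabola hf α) ∘ HalfStrip.fold = fun z => z.1.im :=
      funext fun z => width_ofParabola_fold hf α z
    rw [this]
    fun_prop

theorem width_nonneg (hf : IsNyikosSeq f) (m : MoorizedNyikos f) : 0 ≤ width m := by
  rcases exists_rep hf m with ⟨p, rfl⟩ | ⟨α, z, -, rfl⟩
  · exact p.2.1.le
  · rw [width_ofParabola_fold]; exact z.2.1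

theorem exists_ofQuadrant_of_width_pos (hf : IsNyikosSeq f) {m : MoorizedNyikos f}
    (h : 0 < width m) : ∃ p, m = ofQuadrant f p := by
  rcases exists_rep hf m with h | ⟨α, z, hz, rfl⟩
  · exact h
  · rw [width_ofParabola_fold, hz] at h
    exact absurd h (lt_irrefl _)

theorem exists_ofParabola_of_width_eq {m : MoorizedNyikos f}
    (h : width m = 0) : ∃ (α : Set.Iio (ω₁ : Ordinal.{0})) (z : HalfStrip),
      z.1.im = 0 ∧ m = ofParabola hf α z.fold := by
  rcases exists_rep hf m with ⟨p, rfl⟩ | h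
  · exact absurd h p.2.1.ne'
  · exact h

theorem coord_fst_of_width_pos (hf : IsNyikosSeq f) {m : MoorizedNyikos f}
    (h : 0 < width m) : (coord m).1 = width m := by
  obtain ⟨p, rfl⟩ := exists_ofQuadrant_of_width_pos hf h
  rfl

theorem eq_of_coord_eq (hf : IsNyikosSeq f) {m n : MoorizedNyikos f} (hm : 0 < width m)
    (hn : 0 < width n) (h : coord m = coord n) : m = n := by
  obtain ⟨p, rfl⟩ := exists_ofQuadrant_of_width_pos hf hm
  obtain ⟨q, rfl⟩ := exists_ofQuadrant_of_width_pos hf hn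
  exact congrArg _ (Subtype.ext h)

theorem continuousAt_coord (hf : IsNyikosSeq f) {m : MoorizedNyikos f}
    (h : 0 < width m) : ContinuousAt coord m := by
  obtain ⟨p, rfl⟩ := exists_ofQuadrant_of_width_pos hf h
  rw [← (isOpenEmbedding_ofQuadrant hf).continuousAt_iff]
  exact continuous_subtype_val.continuousAt

theorem coord_ofParabola_fold {z : HalfStrip} (h : 0 < z.1.im) :
    coord (ofParabola hf α z.fold) = (z.1.im, stripHeight (f α) (z.1.re + 1 / 2) z.1.im) := by
  rw [ofParabola_fold_of_im_pos hf α h]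
  rfl

/-- Different charts around folded intervals are disjoint near the intervals, in the order of the
ordinals. -/
theorem exists_coord_snd_lt {α β : Set.Iio (ω₁ : Ordinal.{0})} (h : α < β) :
    ∃ δ > 0, ∀ v w : ParabolaRegion, 0 < width (ofParabola hf α v) →
      width (ofParabola hf α v) < δ → width (ofParabola hf α v) = width (ofParabola hf β w) →
      (coord (ofParabola hf α v)).2 < (coord (ofParabola hf β w)).2 := by
  obtain ⟨δ, hδ, H⟩ := exists_stripHeight_lt hf h β.2
  refine ⟨δ, hδ, fun v w => ?_⟩
  obtain ⟨v, rfl⟩ := HalfStrip.fold_surjective v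
  obtain ⟨w, rfl⟩ := HalfStrip.fold_surjective w
  intro hv hvδ hvw
  rw [width_ofParabola_fold] at hv hvδ hvw
  rw [width_ofParabola_fold] at hvw
  rw [coord_ofParabola_fold hf α hv, coord_ofParabola_fold hf β (by rwa [← hvw])]
  simp only
  rw [← hvw]
  exact H _ _ _ v.re_mem.1.le v.re_mem.2 w.re_mem.1.le hv hvδ

theorem eq_of_ofParabola_eq {v w : ParabolaRegion} {α β : Set.Iio (ω₁ : Ordinal.{0})}
    (hv : width (ofParabola hf α v) = 0)
    (h : ofParabola hf α v = ofParabola hf β w) : α = β := by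
  obtain ⟨v, rfl⟩ := HalfStrip.fold_surjective v
  obtain ⟨w, rfl⟩ := HalfStrip.fold_surjective w
  have hw := hv
  rw [h, width_ofParabola_fold] at hw
  rw [width_ofParabola_fold] at hv
  rw [ofParabola_fold, ofParabola_fold, proj_toCut_eq_iff] at h
  obtain ⟨w', h1, h2⟩ := h
  have hw' : w'.1.im = 0 := by
    rcases HalfStrip.fold_eq_fold_iff.1 h1 with rfl | h
    · exact hw
    · exact h.1
  have h3 := congrArg Subtype.val h2
  rw [HalfStrip.toCut_of_im_eq hf α hv, HalfStrip.toCut_of_im_eq hf β hw'] at h3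
  injection h3 with h3
  exact Subtype.ext (congrArg LongRay.ord h3)

/-- The tip of a folded interval. -/
def tip : MoorizedNyikos f := ofParabola hf α ⟨0, by norm_num⟩

end MoorizedNyikos

/-! ### The folded surface is a separable, non-metrizable surface -/

theorem not_countable_Iio_omega_one : ¬ (Set.univ : Set (Set.Iio (ω₁ : Ordinal.{0}))).Countable := by
  rw [← Cardinal.le_aleph0_iff_set_countable, Cardinal.mk_univ, Cardinal.mk_Iio_ordinal,
    Cardinal.lift_le_aleph0, not_le]
  simp

/-- An open embedding of an open subset of a two-dimensional normed space gives charts. -/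
theorem exists_planar_chart {E X : Type*} [NormedAddCommGroup E] [NormedSpace ℝ E]
    [TopologicalSpace X] (hE : Module.finrank ℝ E = 2) {U : Set E} (hU : IsOpen U) {i : U → X}
    (hi : IsOpenEmbedding i) (u : U) :
    ∃ e : OpenPartialHomeomorph X (EuclideanSpace ℝ (Fin 2)), i u ∈ e.source := by
  have : FiniteDimensional ℝ E := Module.finite_of_finrank_pos (by omega)
  have : Nonempty U := ⟨u⟩
  let L : E ≃L[ℝ] EuclideanSpace ℝ (Fin 2) := .ofFinrankEq (by simp [hE])
  have hj : IsOpenEmbedding fun v : U => L v.1 :=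
    L.toHomeomorph.isOpenEmbedding.comp hU.isOpenEmbedding_subtypeVal
  refine ⟨(hi.toOpenPartialHomeomorph i).symm.trans (hj.toOpenPartialHomeomorph _), ?_⟩
  simp

theorem exists_disjoint_nhds_of_isOpenEmbedding {Y X : Type*} [TopologicalSpace Y] [T2Space Y]
    [TopologicalSpace X] {e : Y → X} (he : IsOpenEmbedding e) {p q : Y} (h : e p ≠ e q) :
    ∃ u v : Set X, IsOpen u ∧ IsOpen v ∧ e p ∈ u ∧ e q ∈ v ∧ Disjoint u v := by
  obtain ⟨u, v, hu, hv, hp, hq, huv⟩ := t2_separation (fun hpq => h (congrArg e hpq) : p ≠ q)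
  exact ⟨e '' u, e '' v, he.isOpenMap u hu, he.isOpenMap v hv, ⟨p, hp, rfl⟩, ⟨q, hq, rfl⟩,
    (Set.disjoint_image_iff he.injective).2 huv⟩

namespace MoorizedNyikos

variable {f : Ordinal.{0} → ℕ → ℕ} (hf : IsNyikosSeq f) (α β : Set.Iio (ω₁ : Ordinal.{0}))

/-- The folded interval `(α, α + 1)`. -/
def arc : Set (MoorizedNyikos f) := {m | width m = 0} ∩ Set.range (ofParabola hf α)

/-- A common point of positive width below `δ` would have a second coordinate strictly smaller than
itself. At width `0` the point determines its ordinal. -/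
theorem exists_le_width_of_ne {α β : Set.Iio (ω₁ : Ordinal.{0})} (h : α ≠ β) :
    ∃ δ > 0, ∀ m ∈ Set.range (ofParabola hf α) ∩ Set.range (ofParabola hf β), δ ≤ width m := by
  wlog hlt : α < β generalizing α β
  · obtain ⟨δ, hδ, H⟩ := this h.symm (lt_of_le_of_ne (not_lt.1 hlt) h.symm)
    exact ⟨δ, hδ, fun m hm => H m hm.symm⟩
  obtain ⟨δ, hδ, H⟩ := exists_coord_snd_lt hf hlt
  refine ⟨δ, hδ, ?_⟩
  rintro _ ⟨⟨v, rfl⟩, ⟨w, hw⟩⟩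
  by_contra! hlt
  rcases (width_nonneg hf (ofParabola hf α v)).eq_or_lt with h0 | h0
  · exact h (eq_of_ofParabola_eq hf h0.symm hw.symm)
  · have := H v w h0 hlt (by rw [hw])
    rw [hw] at this
    exact lt_irrefl _ this

theorem eq_of_mem_arc {m : MoorizedNyikos f} {α β : Set.Iio (ω₁ : Ordinal.{0})}
    (h : m ∈ arc hf α) (h' : m ∈ Set.range (ofParabola hf β)) : α = β := by
  by_contra hne
  obtain ⟨δ, hδ, H⟩ := exists_le_width_of_ne hf hne
  have := H m ⟨h.2, h'⟩
  rw [h.1] at this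
  exact absurd hδ this.not_gt

theorem exists_mem_arc {m : MoorizedNyikos f} (h : width m = 0) : ∃ α, m ∈ arc hf α := by
  obtain ⟨α, z, -, rfl⟩ := exists_ofParabola_of_width_eq hf h
  exact ⟨α, h, _, rfl⟩

/-- Within the closed set `width = 0`, the arc is what remains after removing the open chart ranges
of all other ordinals. -/
theorem isClosed_arc : IsClosed (arc hf α) := by
  have : arc hf α = {m | width m = 0} ∩ (⋃ β ≠ α, Set.range (ofParabola hf β))ᶜ := by
    ext m
    refine and_congr_right fun h => ?_
    simp only [Set.mem_compl_iff, Set.mem_iUnion, not_exists]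
    constructor
    · intro h1 β hβ h2
      exact hβ (eq_of_mem_arc hf ⟨h, h1⟩ h2).symm
    · intro h1
      obtain ⟨β, hβ⟩ := exists_mem_arc hf h
      by_cases hβα : β = α
      · exact hβα ▸ hβ.2
      · exact absurd hβ.2 (h1 β hβα)
  rw [this]
  exact (isClosed_eq (continuous_width hf) continuous_const).inter
    (isOpen_biUnion fun β _ => (isOpenEmbedding_ofParabola hf β).isOpen_range).isClosed_compl

theorem width_tip : width (tip hf α) = 0 := by
  have : (⟨0, by norm_num⟩ : ParabolaRegion) = HalfStrip.fold ⟨0, by norm_num⟩ :=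
    Subtype.ext (by simp [HalfStrip.fold])
  rw [tip, this, width_ofParabola_fold]
  rfl

theorem tip_mem_arc : tip hf α ∈ arc hf α := ⟨width_tip hf α, _, rfl⟩

/-- Points of different width are separated by `width`. Points of equal positive width lie in the
quadrant. Two points of width `0` lie either in one chart or in two charts that are disjoint below
some width `δ`. -/
theorem t2Space (hf : IsNyikosSeq f) : T2Space (MoorizedNyikos f) := by
  refine t2Space_iff _ |>.2 fun m n hmn => ?_
  by_cases hw : width m = width n
  swap
  · obtain ⟨u, v, hu, hv, hm, hn, huv⟩ := t2_separation hw
    exact ⟨_, _, hu.preimage (continuous_width hf), hv.preimage (continuous_width hf), hm, hn,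
      huv.preimage _⟩
  rcases (width_nonneg hf m).eq_or_lt with h0 | h0
  swap
  · obtain ⟨p, rfl⟩ := exists_ofQuadrant_of_width_pos hf h0
    obtain ⟨q, rfl⟩ := exists_ofQuadrant_of_width_pos hf (h0.trans_eq hw)
    exact exists_disjoint_nhds_of_isOpenEmbedding (isOpenEmbedding_ofQuadrant hf) hmn
  obtain ⟨α, hm, v, rfl⟩ := exists_mem_arc hf h0.symm
  obtain ⟨β, hn, w, rfl⟩ := exists_mem_arc hf (hw.symm.trans h0.symm)
  rcases eq_or_ne α β with rfl | hαβ
  · exact exists_disjoint_nhds_of_isOpenEmbedding (isOpenEmbedding_ofParabola hf α) hmn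
  obtain ⟨δ, hδ, H⟩ := exists_le_width_of_ne hf hαβ
  refine ⟨Set.range (ofParabola hf α) ∩ {m | width m < δ}, Set.range (ofParabola hf β),
    (isOpenEmbedding_ofParabola hf α).isOpen_range.inter
      (isOpen_lt (continuous_width hf) continuous_const),
    (isOpenEmbedding_ofParabola hf β).isOpen_range, ⟨⟨v, rfl⟩, ?_⟩, ⟨w, rfl⟩, ?_⟩
  · simpa [← h0] using hδ
  · rw [Set.disjoint_left]
    rintro x ⟨hx1, hx2⟩ hx3
    exact absurd (H x ⟨hx1, hx3⟩) (not_le.2 hx2)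

theorem exists_chart (hf : IsNyikosSeq f) (m : MoorizedNyikos f) :
    ∃ e : OpenPartialHomeomorph (MoorizedNyikos f) (EuclideanSpace ℝ (Fin 2)), m ∈ e.source := by
  rcases exists_rep hf m with ⟨p, rfl⟩ | ⟨α, z, -, rfl⟩
  · refine exists_planar_chart (E := ℝ × ℝ) (U := {p | 0 < p.1 ∧ p.2 < 0}) (by simp) ?_
      (isOpenEmbedding_ofQuadrant hf) p
    exact (isOpen_lt continuous_const continuous_fst).inter
      (isOpen_lt continuous_snd continuous_const)
  · refine exists_planar_chart (E := ℂ) (U := {w | ‖w‖ + w.re < 1 / 2}) (by simp) ?_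
      (isOpenEmbedding_ofParabola hf α) z.fold
    exact isOpen_lt (by fun_prop) continuous_const

/-- A curve into the quadrant ending at a point of a folded interval. -/
theorem exists_curve {z : HalfStrip} (hz : z.1.im = 0) : ∃ c : ℝ → MoorizedNyikos f, Continuous c ∧
    c 0 = ofParabola hf α z.fold ∧ ∀ t ≠ 0, c t ∈ Set.range (ofQuadrant f) := by
  let c : ℝ → HalfStrip := fun t => ⟨⟨z.1.re, |t|⟩, abs_nonneg t, z.2.2⟩
  have hc : Continuous c := by
    refine Continuous.subtype_mk ?_ _
    have : (fun t : ℝ => (⟨z.1.re, |t|⟩ : ℂ)) = fun t : ℝ => (z.1.re : ℂ) + (|t| : ℝ) * Complex.I := by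
      ext1 t
      exact Complex.mk_eq_add_mul_I _ _
    rw [this]
    fun_prop
  refine ⟨fun t => ofParabola hf α (c t).fold,
    (ofParabola hf α).continuous.comp (HalfStrip.continuous_fold.comp hc), ?_, fun t ht => ?_⟩
  · have : c 0 = z := Subtype.ext (Complex.ext rfl (by simp [c, hz]))
    simp only [this]
  · exact ⟨_, (ofParabola_fold_of_im_pos hf α (z := c t) (abs_pos.2 ht)).symm⟩

theorem denseRange_ofQuadrant (hf : IsNyikosSeq f) : DenseRange (ofQuadrant f) := by
  intro m
  rcases exists_rep hf m with ⟨p, rfl⟩ | ⟨α, z, hz, rfl⟩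
  · exact subset_closure ⟨p, rfl⟩
  · obtain ⟨c, hc, h0, h⟩ := exists_curve hf α hz
    rw [← h0]
    refine mem_closure_of_tendsto (hc.continuousAt.tendsto.mono_left
      (nhdsWithin_le_nhds (s := {0}ᶜ))) ?_
    filter_upwards [self_mem_nhdsWithin] with t ht using h t ht

theorem separableSpace (hf : IsNyikosSeq f) : TopologicalSpace.SeparableSpace (MoorizedNyikos f) :=
  (denseRange_ofQuadrant hf).separableSpace (isOpenEmbedding_ofQuadrant hf).continuous

theorem contractibleSpace_quadrant : ContractibleSpace Quadrant := by
  refine Convex.contractibleSpace (s := {p : ℝ × ℝ | 0 < p.1 ∧ p.2 < 0}) ?_ ⟨(1, -1), by simp⟩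
  exact (convex_halfSpace_gt (LinearMap.fst ℝ ℝ ℝ).isLinear 0).inter
    (convex_halfSpace_lt (LinearMap.snd ℝ ℝ ℝ).isLinear 0)

/-- A base point in the quadrant. -/
def basePoint (f : Ordinal.{0} → ℕ → ℕ) : MoorizedNyikos f := ofQuadrant f ⟨(1, -1), by simp⟩

theorem pathConnectedSpace (hf : IsNyikosSeq f) : PathConnectedSpace (MoorizedNyikos f) := by
  have := contractibleSpace_quadrant
  have hQ : ∀ p, Joined (basePoint f) (ofQuadrant f p) := fun p =>
    ⟨(PathConnectedSpace.somePath _ p).map (isOpenEmbedding_ofQuadrant hf).continuous⟩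
  have h : ∀ m, Joined (basePoint f) m := by
    intro m
    rcases exists_rep hf m with ⟨p, rfl⟩ | ⟨α, z, hz, rfl⟩
    · exact hQ p
    · obtain ⟨c, hc, h0, h⟩ := exists_curve hf α hz
      obtain ⟨p, hp⟩ := h 1 one_ne_zero
      rw [← h0]
      exact (hp ▸ hQ p).trans ⟨(PathConnectedSpace.somePath 1 0).map hc⟩
  exact ⟨⟨basePoint f⟩, fun x y => (h x).symm.trans (h y)⟩

theorem isSurface (hf : IsNyikosSeq f) : IsSurface (MoorizedNyikos f) :=
  have := pathConnectedSpace hf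
  ⟨t2Space hf, inferInstance, exists_chart hf⟩

/-- Otherwise the surface would be second countable, and countably many chart ranges would cover the
union of all of them. But each tip belongs only to the chart of its own ordinal. -/
theorem not_metrizableSpace (hf : IsNyikosSeq f) :
    ¬ TopologicalSpace.MetrizableSpace (MoorizedNyikos f) := by
  intro hm
  have := separableSpace hf
  let _ := TopologicalSpace.metrizableSpaceMetric (MoorizedNyikos f)
  have := UniformSpace.secondCountable_of_separable (MoorizedNyikos f)
  obtain ⟨T, hT, hTU⟩ := TopologicalSpace.isOpen_iUnion_countable
    (fun α => Set.range (ofParabola hf α)) fun α => (isOpenEmbedding_ofParabola hf α).isOpen_range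
  refine not_countable_Iio_omega_one (hT.mono fun α _ => ?_)
  have : tip hf α ∈ ⋃ α ∈ T, Set.range (ofParabola hf α) := by
    rw [hTU]
    exact Set.mem_iUnion.2 ⟨α, _, rfl⟩
  simp only [Set.mem_iUnion] at this
  obtain ⟨β, hβ, h⟩ := this
  rwa [eq_of_mem_arc hf (tip_mem_arc hf α) h]

/-- The part of `K` of width `0` is compact, and it is covered by the chart ranges, each of which
meets only its own arc. -/
theorem finite_setOf_arc_inter {K : Set (MoorizedNyikos f)} (hK : IsCompact K) :
    {α | (K ∩ arc hf α).Nonempty}.Finite := by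
  have hK' : IsCompact (K ∩ {m | width m = 0}) :=
    hK.inter_right (isClosed_eq (continuous_width hf) continuous_const)
  obtain ⟨t, ht⟩ := hK'.elim_finite_subcover (fun α => Set.range (ofParabola hf α))
    (fun α => (isOpenEmbedding_ofParabola hf α).isOpen_range) fun m hm => by
      obtain ⟨α, hα⟩ := exists_mem_arc hf hm.2
      exact Set.mem_iUnion.2 ⟨α, hα.2⟩
  refine t.finite_toSet.subset ?_
  rintro α ⟨m, hm, hmα⟩
  have := ht ⟨hm, hmα.1⟩
  simp only [Set.mem_iUnion] at this
  obtain ⟨β, hβ, h⟩ := this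
  rw [eq_of_mem_arc hf hmα h]
  exact hβ

theorem two_mul_width_sq (w : ParabolaRegion) :
    2 * width (ofParabola hf α w) ^ 2 = ‖w.1‖ - w.1.re := by
  obtain ⟨z, rfl⟩ := HalfStrip.fold_surjective w
  rw [width_ofParabola_fold]
  exact (norm_sq_sub_re_sq z.1).symm

/-- In the chart, the folded interval is the trace of the nonnegative real axis: its end at `0` is
what both the pushing homotopy and the leaf argument use. -/
theorem width_ofParabola_eq_zero_iff {w : ParabolaRegion} :
    width (ofParabola hf α w) = 0 ↔ 0 ≤ w.1.re ∧ w.1.im = 0 := by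
  have h := two_mul_width_sq hf α w
  rw [eq_comm (b := (0 : ℝ)) (a := w.1.im), ← Complex.nonneg_iff, ← Complex.re_eq_norm]
  constructor
  · intro h0
    rw [h0] at h
    linarith
  · intro h0
    have : width (ofParabola hf α w) ^ 2 = 0 := by rw [h0] at h; linarith
    exact pow_eq_zero_iff two_ne_zero |>.1 this

end MoorizedNyikos

/-! ### Simple connectivity -/

open Path.Homotopic.Quotient in
/-- In a path connected space it suffices to contract the loops at one point. -/
theorem simplyConnectedSpace_of_loops {Y : Type*} [TopologicalSpace Y] [PathConnectedSpace Y]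
    (x₀ : Y) (h : ∀ γ : Path x₀ x₀, Path.Homotopic γ (Path.refl x₀)) : SimplyConnectedSpace Y := by
  refine simply_connected_iff_loops_nullhomotopic.2 ⟨inferInstance, fun x γ => ?_⟩
  let p : Path x₀ x := PathConnectedSpace.somePath x₀ x
  rw [← eq]
  have h1 : ((mk p).trans (mk γ)).trans (mk p).symm = refl x₀ := by
    rw [← mk_trans, ← mk_symm, ← mk_trans, ← mk_refl]
    exact eq.2 (h _)
  have h2 : mk γ = ((mk p).symm).trans ((((mk p).trans (mk γ)).trans (mk p).symm).trans (mk p)) := by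
    simp only [Path.Homotopic.Quotient.trans_assoc, Path.Homotopic.Quotient.symm_trans,
      Path.Homotopic.Quotient.trans_refl]
    rw [← Path.Homotopic.Quotient.trans_assoc]
    simp
  rw [h2, h1]
  simp

namespace ParabolaRegion

/-- Translating a point of the parabola region to the left. -/
def shift (c : ℝ) (hc : 0 ≤ c) (w : ParabolaRegion) : ParabolaRegion :=
  ⟨w.1 - c, by
    have h := w.2
    -- The norm grows by at most `c` while the real part drops by exactly `c`, so the sum defining
    -- the region does not increase.
    have h1 : ‖w.1 - c‖ ≤ ‖w.1‖ + c := by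
      simpa [abs_of_nonneg hc] using norm_sub_le w.1 (c : ℂ)
    have h2 : (w.1 - c).re = w.1.re - c := by simp
    linarith⟩

end ParabolaRegion

namespace MoorizedNyikos

variable {f : Ordinal.{0} → ℕ → ℕ} (hf : IsNyikosSeq f) (α β : Set.Iio (ω₁ : Ordinal.{0}))

open Classical in
/-- The homotopy that moves the points of one chart to the left, by the amount `φ`. -/
def push (φ : C(ParabolaRegion, ℝ)) (hφ : ∀ w, 0 ≤ φ w)
    (x : unitInterval × MoorizedNyikos f) : MoorizedNyikos f :=
  if h : ∃ w, ofParabola hf α w = x.2 then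
    ofParabola hf α (ParabolaRegion.shift (x.1 * φ h.choose)
      (mul_nonneg x.1.2.1 (hφ _)) h.choose)
  else x.2

variable (φ : C(ParabolaRegion, ℝ)) (hφ : ∀ w, 0 ≤ φ w)

theorem push_ofParabola (τ : unitInterval) (w : ParabolaRegion) :
    push hf α φ hφ (τ, ofParabola hf α w) = ofParabola hf α
      (ParabolaRegion.shift (τ * φ w) (mul_nonneg τ.2.1 (hφ _)) w) := by
  have h : ∃ w', ofParabola hf α w' = ofParabola hf α w := ⟨w, rfl⟩
  have hw : h.choose = w := ofParabola_injective hf α h.choose_spec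
  rw [push, dif_pos h]
  simp only [hw]

theorem push_of_notMem {x : unitInterval × MoorizedNyikos f}
    (h : x.2 ∉ Set.range (ofParabola hf α)) : push hf α φ hφ x = x.2 :=
  dif_neg h

theorem push_of_eq_zero {τ : unitInterval} {w : ParabolaRegion} (h : τ * φ w = 0) :
    push hf α φ hφ (τ, ofParabola hf α w) = ofParabola hf α w := by
  rw [push_ofParabola]
  exact congrArg _ (Subtype.ext (by simp only [ParabolaRegion.shift, h]; simp))

theorem push_zero (m : MoorizedNyikos f) : push hf α φ hφ (0, m) = m := by
  by_cases h : m ∈ Set.range (ofParabola hf α)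
  · obtain ⟨w, rfl⟩ := h
    exact push_of_eq_zero hf α φ hφ (by simp)
  · exact push_of_notMem hf α φ hφ (x := (0, m)) h

/-- The image of the compact support of `φ` is closed in the Hausdorff surface. Outside it nothing
moves, so the definition by cases is continuous also at points outside the chart. -/
theorem continuous_push (hs : HasCompactSupport φ) : Continuous (push hf α φ hφ) := by
  have := t2Space hf
  refine continuous_iff_continuousAt.2 fun ⟨τ, m⟩ => ?_
  by_cases h : m ∈ Set.range (ofParabola hf α)
  · obtain ⟨w, rfl⟩ := h
    have he : IsOpenEmbedding (Prod.map id (ofParabola hf α) :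
        unitInterval × ParabolaRegion → unitInterval × MoorizedNyikos f) :=
      IsOpenEmbedding.id.prodMap (isOpenEmbedding_ofParabola hf α)
    change ContinuousAt (push hf α φ hφ) (Prod.map id (ofParabola hf α) (τ, w))
    rw [← he.continuousAt_iff]
    have : push hf α φ hφ ∘ Prod.map id (ofParabola hf α) = fun x => ofParabola hf α
        (ParabolaRegion.shift (x.1 * φ x.2) (mul_nonneg x.1.2.1 (hφ _)) x.2) :=
      funext fun x => push_ofParabola hf α φ hφ x.1 x.2
    rw [this]
    refine ((ofParabola hf α).continuous.comp (Continuous.subtype_mk ?_ _)).continuousAt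
    fun_prop
  · have hC : IsClosed (ofParabola hf α '' tsupport φ) :=
      (hs.isCompact.image (ofParabola hf α).continuous).isClosed
    have hmem : Prod.snd ⁻¹' (ofParabola hf α '' tsupport φ)ᶜ ∈ 𝓝 (τ, m) :=
      (hC.isOpen_compl.preimage continuous_snd).mem_nhds fun ⟨w, _, hw⟩ => h ⟨w, hw⟩
    refine continuous_snd.continuousAt.congr ?_
    filter_upwards [hmem] with x hx
    by_cases hx' : x.2 ∈ Set.range (ofParabola hf α)
    · obtain ⟨w, hw⟩ := hx'
      have h0 : φ w = 0 := by
        by_contra hne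
        exact hx ⟨w, subset_tsupport _ hne, hw⟩
      obtain ⟨τ', m'⟩ := x
      simp only at hw
      subst hw
      exact (push_of_eq_zero hf α φ hφ (by rw [h0, mul_zero])).symm
    · exact (push_of_notMem hf α φ hφ hx').symm

/-- A path in the surface with ends in the quadrant can be pushed off one folded interval. -/
theorem exists_homotopic_disjoint {x : MoorizedNyikos f} (hx : 0 < width x) (γ : Path x x) :
    ∃ γ' : Path x x, Path.Homotopic γ γ' ∧ Disjoint (Set.range γ') (arc hf α) ∧
      ∀ β, Disjoint (Set.range γ) (arc hf β) → Disjoint (Set.range γ') (arc hf β) := by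
  have := t2Space hf
  have hlc : LocallyCompactSpace ParabolaRegion :=
    (isOpen_lt (by fun_prop) continuous_const : IsOpen {w : ℂ | ‖w‖ + w.re < 1 / 2}).locallyCompactSpace
  let S : Set ParabolaRegion := ofParabola hf α ⁻¹' (Set.range γ ∩ arc hf α)
  have hS : IsCompact S := by
    refine ((isOpenEmbedding_ofParabola hf α).isInducing.isCompact_preimage_iff ?_).2
      ((isCompact_range γ.continuous).inter_right (isClosed_arc hf α))
    exact fun m hm => hm.2.2
  -- The shift is by `1` where the loop meets the arc, and by `0` at the base point, which is not on
  -- the arc because its width is positive.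
  obtain ⟨φ, h1, h0, hs, hI⟩ := exists_continuous_one_zero_of_isCompact hS
    (isClosed_singleton.preimage (ofParabola hf α).continuous : IsClosed (ofParabola hf α ⁻¹' {x}))
    (by
      rw [Set.disjoint_left]
      intro w hw hwx
      have := hw.2.1
      rw [show ofParabola hf α w = x from hwx] at this
      exact hx.ne' this)
  have hφ : ∀ w, 0 ≤ φ w := fun w => (hI w).1
  have hpx : ∀ τ, push hf α φ hφ (τ, x) = x := by
    intro τ
    by_cases h : x ∈ Set.range (ofParabola hf α)
    · obtain ⟨w, hw⟩ := h
      have hw0 : φ w = 0 := h0 hw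
      have := push_of_eq_zero hf α φ hφ (τ := τ) (w := w) (by rw [hw0, mul_zero])
      rwa [hw] at this
    · exact push_of_notMem hf α φ hφ (x := (τ, x)) h
  have hc := continuous_push hf α φ hφ hs
  let γ' : Path x x :=
    { toFun := fun t => push hf α φ hφ (1, γ t)
      continuous_toFun := hc.comp (by fun_prop)
      source' := by simp only [γ.source, hpx]
      target' := by simp only [γ.target, hpx] }
  refine ⟨γ', ⟨{
    toFun := fun p => push hf α φ hφ (p.1, γ p.2)
    continuous_toFun := hc.comp (by fun_prop)
    map_zero_left := fun t => push_zero hf α φ hφ _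
    map_one_left := fun t => rfl
    prop' := ?_ }⟩, ?_, ?_⟩
  · rintro τ t (rfl | rfl)
    · exact (congrArg (fun m => push hf α φ hφ (τ, m)) γ.source).trans
        ((hpx τ).trans γ.source.symm)
    · exact (congrArg (fun m => push hf α φ hφ (τ, m)) γ.target).trans
        ((hpx τ).trans γ.target.symm)
  · rw [Set.disjoint_left]
    rintro _ ⟨t, rfl⟩ h
    change push hf α φ hφ (1, γ t) ∈ _ at h
    by_cases ht : γ t ∈ Set.range (ofParabola hf α)
    · obtain ⟨w, hw⟩ := ht
      rw [← hw, push_ofParabola] at h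
      obtain ⟨g1, g2⟩ := (width_ofParabola_eq_zero_iff hf α).1 h.1
      simp only [ParabolaRegion.shift, Set.Icc.coe_one, one_mul, Complex.sub_re, Complex.ofReal_re,
        Complex.sub_im, Complex.ofReal_im, sub_zero] at g1 g2
      -- A point that ends on the real half-line after moving left was already on it, hence in `S`.
      -- It was moved by `1`, so its real part was at least `1`, which is impossible in the parabola
      -- region.
      have hwS : w ∈ S :=
        ⟨⟨t, hw.symm⟩, (width_ofParabola_eq_zero_iff hf α).2 ⟨by linarith [hφ w], g2⟩, w, rfl⟩
      have e : φ w = 1 := h1 hwS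
      have := w.2
      have := Complex.re_le_norm w.1
      linarith
    · rw [push_of_notMem hf α φ hφ (x := (1, γ t)) ht] at h
      exact ht h.2
  · intro β hβ
    rw [Set.disjoint_left] at hβ ⊢
    rintro _ ⟨t, rfl⟩ h
    change push hf α φ hφ (1, γ t) ∈ _ at h
    by_cases ht : γ t ∈ Set.range (ofParabola hf α)
    · obtain ⟨w, hw⟩ := ht
      rw [← hw, push_ofParabola] at h
      -- Moved points stay in the chart of `α`, so the only arc they can lie on is that of `α`. As
      -- above, they were on it before the shift.
      obtain rfl : β = α := eq_of_mem_arc hf h ⟨_, rfl⟩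
      obtain ⟨g1, g2⟩ := (width_ofParabola_eq_zero_iff hf β).1 h.1
      simp only [ParabolaRegion.shift, Set.Icc.coe_one, one_mul, Complex.sub_re, Complex.ofReal_re,
        Complex.sub_im, Complex.ofReal_im, sub_zero] at g1 g2
      exact hβ ⟨t, rfl⟩ ⟨by
        rw [← hw]
        exact (width_ofParabola_eq_zero_iff hf β).2 ⟨by linarith [hφ w], g2⟩, w, hw⟩
    · rw [push_of_notMem hf α φ hφ (x := (1, γ t)) ht] at h
      exact hβ ⟨t, rfl⟩ h

theorem homotopic_refl_of_width_pos (hf : IsNyikosSeq f) (γ : Path (basePoint f) (basePoint f))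
    (h : ∀ t, 0 < width (γ t)) : Path.Homotopic γ (Path.refl _) := by
  have := contractibleSpace_quadrant
  have hmem : ∀ t, 0 < (coord (γ t)).1 ∧ (coord (γ t)).2 < 0 := by
    intro t
    obtain ⟨p, hp⟩ := exists_ofQuadrant_of_width_pos hf (h t)
    rw [hp]
    exact p.2
  let γ' : Path (⟨(1, -1), by simp⟩ : Quadrant) ⟨(1, -1), by simp⟩ :=
    { toFun := fun t => ⟨coord (γ t), hmem t⟩
      continuous_toFun := Continuous.subtype_mk (continuous_iff_continuousAt.2 fun t =>
        (continuousAt_coord hf (h t)).comp γ.continuous.continuousAt) hmem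
      source' := Subtype.ext (by simp only [γ.source]; rfl)
      target' := Subtype.ext (by simp only [γ.target]; rfl) }
  have h1 := (SimplyConnectedSpace.paths_homotopic γ' (Path.refl _)).map
    ⟨ofQuadrant f, (isOpenEmbedding_ofQuadrant hf).continuous⟩
  have h2 : γ'.map (isOpenEmbedding_ofQuadrant hf).continuous = γ := by
    ext t
    obtain ⟨p, hp⟩ := exists_ofQuadrant_of_width_pos hf (h t)
    change ofQuadrant f ⟨coord (γ t), _⟩ = γ t
    simp only [hp, coord_ofQuadrant]
  rw [← h2]
  exact h1

/-- Induction on the size of a finite set of ordinals containing all those whose arcs the loop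
meets. Each push removes one element and adds none. With no arcs left, the loop lies in the
quadrant. -/
theorem simplyConnectedSpace (hf : IsNyikosSeq f) : SimplyConnectedSpace (MoorizedNyikos f) := by
  have := pathConnectedSpace hf
  refine simplyConnectedSpace_of_loops (basePoint f) fun γ => ?_
  have key : ∀ (n : ℕ) (γ : Path (basePoint f) (basePoint f)) (F : Finset (Set.Iio (ω₁ : Ordinal.{0}))),
      F.card = n → (∀ β ∉ F, Disjoint (Set.range γ) (arc hf β)) →
      Path.Homotopic γ (Path.refl _) := by
    intro n
    induction n with
    | zero =>
      intro γ F hF h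
      rw [Finset.card_eq_zero] at hF
      subst hF
      refine homotopic_refl_of_width_pos hf γ fun t => ?_
      refine lt_of_le_of_ne (width_nonneg hf _) fun h0 => ?_
      obtain ⟨β, hβ⟩ := exists_mem_arc hf h0.symm
      exact Set.disjoint_left.1 (h β (Finset.notMem_empty β)) ⟨t, rfl⟩ hβ
    | succ n ih =>
      intro γ F hF h
      classical
      obtain ⟨α, hα⟩ : F.Nonempty := Finset.card_pos.1 (by omega)
      obtain ⟨γ', h1, h2, h3⟩ := exists_homotopic_disjoint hf α
        (x := basePoint f) (by rw [basePoint, width_ofQuadrant]; norm_num) γ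
      refine h1.trans (ih γ' (F.erase α) (by rw [Finset.card_erase_of_mem hα]; omega) fun β hβ => ?_)
      by_cases hβα : β = α
      · rwa [hβα]
      · exact h3 β (h β fun hβF => hβ (Finset.mem_erase.2 ⟨hβα, hβF⟩))
  have hfin := finite_setOf_arc_inter hf (isCompact_range γ.continuous)
  refine key _ γ hfin.toFinset rfl fun β hβ => ?_
  rw [Set.Finite.mem_toFinset, Set.mem_ofPred_eq, Set.not_nonempty_iff_eq_empty] at hβ
  exact Set.disjoint_iff_inter_eq_empty.2 hβ

end MoorizedNyikos

/-! ### Disjoint curves across a vertical strip do not change their order -/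

/-- On the slit plane the principal logarithm is a second continuous lift through `exp`, and two
lifts over an interval differ by a constant. -/
theorem sub_eq_log_sub_log {l g : ℝ → ℂ} (hl : ContinuousOn l (Set.Icc 0 1))
    (hg : ContinuousOn g (Set.Icc 0 1)) (h : ∀ t ∈ Set.Icc (0 : ℝ) 1, Complex.exp (l t) = g t)
    (hs : ∀ t ∈ Set.Icc (0 : ℝ) 1, g t ∈ Complex.slitPlane) :
    l 1 - l 0 = Complex.log (g 1) - Complex.log (g 0) := by
  have hc : ContinuousOn (fun t => l t - Complex.log (g t)) (Set.Icc 0 1) := hl.sub (hg.clog hs)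
  have h1 : ∀ t ∈ Set.Icc (0 : ℝ) 1, Complex.exp (l t - Complex.log (g t)) = 1 := by
    intro t ht
    have h0 : g t ≠ 0 := Complex.slitPlane_ne_zero (hs t ht)
    rw [Complex.exp_sub, h t ht, Complex.exp_log h0, div_self h0]
  have := Complex.isCoveringMap_exp.constOn_of_comp isPreconnected_Icc hc
    (fun t ht t' ht' => Subtype.ext (by simp only [h1 t ht, h1 t' ht']))
    (Set.right_mem_Icc.2 zero_le_one) (Set.left_mem_Icc.2 zero_le_one)
  linear_combination this

theorem mem_slitPlane_of_re_nonneg {z : ℂ} (h : 0 ≤ z.re) (h0 : z ≠ 0) : z ∈ Complex.slitPlane := by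
  rcases h.eq_or_lt with h | h
  · exact Or.inr fun hi => h0 (Complex.ext h.symm hi)
  · exact Or.inl h

/-- Two disjoint curves that cross the vertical strip between `s₀` and `s₁` have the same order on
both sides. -/
theorem im_le_im_of_disjoint {a b : ℝ → ℂ} {s₀ s₁ : ℝ} (ha : ContinuousOn a (Set.Icc 0 1))
    (hb : ContinuousOn b (Set.Icc 0 1))
    (har : ∀ t ∈ Set.Icc (0 : ℝ) 1, s₀ ≤ (a t).re ∧ (a t).re ≤ s₁)
    (hbr : ∀ t ∈ Set.Icc (0 : ℝ) 1, s₀ ≤ (b t).re ∧ (b t).re ≤ s₁)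
    (ha0 : (a 0).re = s₀) (hb0 : (b 0).re = s₀) (ha1 : (a 1).re = s₁) (hb1 : (b 1).re = s₁)
    (hd : ∀ t ∈ Set.Icc (0 : ℝ) 1, ∀ t' ∈ Set.Icc (0 : ℝ) 1, a t ≠ b t')
    (h0 : (a 0).im < (b 0).im) : (a 1).im ≤ (b 1).im := by
  by_contra! h1
  have m0 : (0 : ℝ) ∈ Set.Icc (0 : ℝ) 1 := by simp
  have m1 : (1 : ℝ) ∈ Set.Icc (0 : ℝ) 1 := by simp
  let P : ℝ → Set.Icc (0 : ℝ) 1 := Set.projIcc 0 1 zero_le_one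
  have hP : ∀ t (ht : t ∈ Set.Icc (0 : ℝ) 1), ((P t : Set.Icc (0 : ℝ) 1) : ℝ) = t := fun t ht => by
    simp only [P, Set.projIcc_of_mem _ ht]
  have hPc : Continuous P := continuous_projIcc
  -- Disjointness makes `F (u, v) = a u - b v` nonvanishing on the square, so it has a continuous
  -- logarithm `L`. Projecting the variables to `[0, 1]` extends `F` to the simply connected plane.
  let F : C(ℝ × ℝ, ℂ) := ⟨fun p => a (P p.1) - b (P p.2),
    (ha.comp_continuous (f := fun p : ℝ × ℝ => (P p.1 : ℝ)) (by fun_prop) fun p => (P p.1).2).sub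
      (hb.comp_continuous (f := fun p : ℝ × ℝ => (P p.2 : ℝ)) (by fun_prop) fun p => (P p.2).2)⟩
  have hF0 : ∀ p, F p ≠ 0 := fun p => sub_ne_zero.2 (hd _ (P p.1).2 _ (P p.2).2)
  obtain ⟨L, ⟨-, hL⟩, -⟩ := Complex.isCoveringMapOn_exp.existsUnique_continuousMap_lifts F
    (a₀ := (0, 0)) (e₀ := Complex.log (F (0, 0))) (Complex.exp_log (hF0 _)) fun p => hF0 p
  have hL' : ∀ p, Complex.exp (L p) = F p := fun p => congrFun hL p
  have e1 := sub_eq_log_sub_log (l := fun u => L (u, 0)) (g := fun u => F (u, 0))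
    (by fun_prop) (by fun_prop) (fun t _ => hL' _) fun t ht => by
      refine mem_slitPlane_of_re_nonneg ?_ (hF0 _)
      have := (har t ht).1
      simp only [F, ContinuousMap.coe_mk, hP t ht, hP 0 m0, Complex.sub_re]
      linarith
  have e2 := sub_eq_log_sub_log (l := fun v => L (1, v)) (g := fun v => F (1, v))
    (by fun_prop) (by fun_prop) (fun t _ => hL' _) fun t ht => by
      refine mem_slitPlane_of_re_nonneg ?_ (hF0 _)
      have := (hbr t ht).2
      simp only [F, ContinuousMap.coe_mk, hP t ht, hP 1 m1, Complex.sub_re]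
      linarith
  have hneg : ∀ p, Complex.exp (L p + Real.pi * Complex.I) = -F p := fun p => by
    rw [Complex.exp_add, hL', Complex.exp_pi_mul_I]; ring
  have e3 := sub_eq_log_sub_log (l := fun v => L (0, v) + Real.pi * Complex.I)
    (g := fun v => -F (0, v)) (by fun_prop) (by fun_prop) (fun t _ => hneg _) fun t ht => by
      refine mem_slitPlane_of_re_nonneg ?_ (neg_ne_zero.2 (hF0 _))
      have := (hbr t ht).1
      simp only [F, ContinuousMap.coe_mk, hP t ht, hP 0 m0, Complex.sub_re, Complex.neg_re]
      linarith
  have e4 := sub_eq_log_sub_log (l := fun u => L (u, 1) + Real.pi * Complex.I)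
    (g := fun u => -F (u, 1)) (by fun_prop) (by fun_prop) (fun t _ => hneg _) fun t ht => by
      refine mem_slitPlane_of_re_nonneg ?_ (neg_ne_zero.2 (hF0 _))
      have := (har t ht).2
      simp only [F, ContinuousMap.coe_mk, hP t ht, hP 1 m1, Complex.sub_re, Complex.neg_re]
      linarith
  -- The increment of `L` from `(0, 0)` to `(1, 1)` is computed along both pairs of edges. On the
  -- first pair `Re F ≥ 0`; on the other `Re F ≤ 0`, so `-F` is used. If the order changed, `F`
  -- would be negative imaginary at `(0, 0)` and positive imaginary at `(1, 1)`, and the increments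
  -- of the argument would be `π` and `-π`.
  have E : Complex.log (F (1, 1)) - Complex.log (F (0, 0)) =
      Complex.log (-F (1, 1)) - Complex.log (-F (0, 0)) := by
    linear_combination -e1 - e2 + e3 + e4
  have E' := congrArg Complex.im E
  have f00 : F (0, 0) = a 0 - b 0 := by simp only [F, ContinuousMap.coe_mk, hP 0 m0]
  have f11 : F (1, 1) = a 1 - b 1 := by simp only [F, ContinuousMap.coe_mk, hP 1 m1]
  rw [Complex.sub_im, Complex.sub_im, Complex.log_im, Complex.log_im, Complex.log_im,
    Complex.log_im, f00, f11, Complex.arg_eq_pi_div_two_iff.2, Complex.arg_eq_neg_pi_div_two_iff.2,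
    Complex.arg_eq_neg_pi_div_two_iff.2, Complex.arg_eq_pi_div_two_iff.2] at E'
  · linarith [Real.pi_pos]
  all_goals
    constructor <;> simp only [Complex.sub_re, Complex.sub_im, Complex.neg_re, Complex.neg_im] <;>
      linarith

/-! ### Arcs in the leaves of a foliation -/

/-- A parametrized compact arc in a leaf of a foliation, inside one chart. -/
structure LeafArc {Y : Type*} [TopologicalSpace Y] (F : Foliation Y) where
  chart : OpenPartialHomeomorph Y (ℝ × ℝ)
  chart_mem : chart ∈ F.charts
  start : ℝ
  dir : ℝ
  height : ℝ
  dir_ne : dir ≠ 0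
  mem_target : ∀ u ∈ Set.Icc (0 : ℝ) 1, (start + u * dir, height) ∈ chart.target

namespace LeafArc

variable {Y : Type*} [TopologicalSpace Y] {F : Foliation Y}

/-- The points of the arc. -/
def pt (a : LeafArc F) (u : ℝ) : Y := a.chart.symm (a.start + u * a.dir, a.height)

theorem continuousAt_pt (a : LeafArc F) {u : ℝ} (hu : u ∈ Set.Icc (0 : ℝ) 1) :
    ContinuousAt a.pt u := by
  refine ContinuousAt.comp (f := fun u => (a.start + u * a.dir, a.height))
    (a.chart.continuousAt_symm (a.mem_target u hu)) ?_
  fun_prop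

/-- Near a common point, one arc is a reparametrization of the other. -/
theorem exists_reparam (a b : LeafArc F) {u v : ℝ} (hu : u ∈ Set.Icc (0 : ℝ) 1)
    (hv : v ∈ Set.Icc (0 : ℝ) 1) (h : a.pt u = b.pt v) :
    ∃ φ : ℝ → ℝ, φ u = v ∧ (∀ᶠ u' in 𝓝 u, ContinuousAt φ u') ∧
      ∀ᶠ u' in 𝓝 u, a.pt u' = b.pt (φ u') := by
  let P : ℝ → ℝ × ℝ := fun u => (a.start + u * a.dir, a.height)
  have hP : Continuous P := by fun_prop
  have hsrc : P u ∈ (a.chart.symm.trans b.chart).source := by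
    rw [OpenPartialHomeomorph.trans_source]
    refine ⟨a.mem_target u hu, ?_⟩
    change a.pt u ∈ b.chart.source
    rw [h]
    exact b.chart.map_target (b.mem_target v hv)
  have hbv : b.chart (b.pt v) = (b.start + v * b.dir, b.height) :=
    b.chart.right_inv (b.mem_target v hv)
  obtain ⟨V, hV, huV, hVs, g, -, hg⟩ := F.compatible _ a.chart_mem _ b.chart_mem (P u) hsrc
  -- The coordinate change sends heights to heights, so near the common point `a` stays on the
  -- horizontal line of `b`; the first coordinate there is the new parameter.
  have hh : g a.height = b.height := by
    have := hg (P u) huV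
    change (b.chart (a.pt u)).2 = _ at this
    rw [h, hbv] at this
    exact this.symm
  have hev : ∀ᶠ u' in 𝓝 u, P u' ∈ V := hP.continuousAt.eventually (hV.mem_nhds huV)
  refine ⟨fun u' => ((b.chart (a.pt u')).1 - b.start) / b.dir, ?_, ?_, ?_⟩
  · simp only [h, hbv]
    field_simp [b.dir_ne]
    ring
  · filter_upwards [hev] with u' hu'
    have h1 : ContinuousAt (a.chart.symm.trans b.chart) (P u') :=
      (a.chart.symm.trans b.chart).continuousAt (hVs hu')
    have h2 : ContinuousAt (fun u' => b.chart (a.pt u')) u' :=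
      ContinuousAt.comp (f := P) h1 hP.continuousAt
    exact (h2.fst.sub continuousAt_const).div_const _
  · filter_upwards [hev] with u' hu'
    have hs := hVs hu'
    rw [OpenPartialHomeomorph.trans_source] at hs
    have h1 : (b.chart (a.pt u')).2 = b.height := (hg _ hu').trans hh
    have h2 : (b.start + ((b.chart (a.pt u')).1 - b.start) / b.dir * b.dir, b.height) =
        b.chart (a.pt u') := by
      refine Prod.ext ?_ h1.symm
      simp only [div_mul_cancel₀ _ b.dir_ne]
      ring
    change _ = b.chart.symm _
    rw [h2]
    exact (b.chart.left_inv hs.2).symm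

/-- An arc that meets the interior of another arc and avoids its end points stays inside. -/
theorem mapsTo_of_meets [T2Space Y] (a b : LeafArc F)
    (h0 : ∀ u ∈ Set.Ioo (0 : ℝ) 1, a.pt u ≠ b.pt 0) (h1 : ∀ u ∈ Set.Ioo (0 : ℝ) 1, a.pt u ≠ b.pt 1)
    {u v : ℝ} (hu : u ∈ Set.Ioo (0 : ℝ) 1) (hv : v ∈ Set.Ioo (0 : ℝ) 1) (h : a.pt u = b.pt v) :
    ∀ u' ∈ Set.Ioo (0 : ℝ) 1, a.pt u' ∈ b.pt '' Set.Ioo 0 1 := by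
  let S : Set ℝ := {u | a.pt u ∈ b.pt '' Set.Ioo 0 1}
  have hopen : ∀ u ∈ Set.Ioo (0 : ℝ) 1, u ∈ S → S ∈ 𝓝 u := by
    rintro u hu ⟨v, hv, hvu⟩
    obtain ⟨φ, hφ, hc, he⟩ := a.exists_reparam b (Set.Ioo_subset_Icc_self hu)
      (Set.Ioo_subset_Icc_self hv) hvu.symm
    have hc' : ContinuousAt φ u := hc.self_of_nhds
    filter_upwards [he, hc'.eventually (by rw [hφ]; exact Ioo_mem_nhds hv.1 hv.2)] with u' h1 h2
    exact ⟨φ u', h2, h1.symm⟩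
  have hclosed : IsClosed (b.pt '' Set.Icc 0 1) :=
    (isCompact_Icc.image_of_continuousOn fun v hv => (b.continuousAt_pt hv).continuousWithinAt).isClosed
  have hS : ∀ u ∈ Set.Ioo (0 : ℝ) 1, a.pt u ∈ b.pt '' Set.Icc 0 1 → u ∈ S := by
    rintro u hu ⟨v, hv, hvu⟩
    refine ⟨v, ⟨lt_of_le_of_ne hv.1 ?_, lt_of_le_of_ne hv.2 ?_⟩, hvu⟩
    · rintro rfl; exact h0 u hu hvu.symm
    · rintro rfl; exact h1 u hu hvu.symm
  have hSS : ∀ u ∈ interior S, a.pt u ∈ b.pt '' Set.Ioo 0 1 :=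
    fun u hu => (interior_subset hu : u ∈ S)
  -- Connectedness of `(0, 1)`: the set `S` is open by local reparametrization. It is relatively
  -- closed because the closed arc `b` is compact and its two ends are avoided.
  have key : Set.Ioo (0 : ℝ) 1 ⊆ interior S := by
    refine isPreconnected_Ioo.subset_of_closure_inter_subset isOpen_interior
      ⟨u, hu, mem_interior_iff_mem_nhds.2 (hopen u hu ⟨v, hv, h.symm⟩)⟩ ?_
    rintro u' ⟨hcl, hu'⟩
    refine mem_interior_iff_mem_nhds.2 (hopen u' hu' (hS u' hu' ?_))
    have hc : ContinuousWithinAt a.pt (interior S) u' :=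
      (a.continuousAt_pt (Set.Ioo_subset_Icc_self hu')).continuousWithinAt
    have := hc.mem_closure_image hcl
    refine hclosed.closure_subset_iff.2 ?_ this
    rintro _ ⟨w, hw, rfl⟩
    exact Set.image_mono Set.Ioo_subset_Icc_self (hSS _ hw)
  exact fun u' hu' => hSS _ (key hu')

/-- Next to a common end point, an arc disjoint from `b` runs on the other side of that point. -/
theorem exists_reparam_gt (a b : LeafArc F) (h : a.pt 1 = b.pt 1)
    (hd : ∀ u ∈ Set.Ioo (0 : ℝ) 1, ∀ v ∈ Set.Ioo (0 : ℝ) 1, a.pt u ≠ b.pt v)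
    (h1 : ∀ u ∈ Set.Ioo (0 : ℝ) 1, a.pt u ≠ b.pt 1) :
    ∃ (φ : ℝ → ℝ), ∃ u₀ ∈ Set.Ioo (0 : ℝ) 1, ContinuousOn φ (Set.Icc u₀ 1) ∧ φ 1 = 1 ∧
      1 < φ u₀ ∧ ∀ u ∈ Set.Icc u₀ 1, a.pt u = b.pt (φ u) := by
  have m1 : (1 : ℝ) ∈ Set.Icc (0 : ℝ) 1 := by simp
  obtain ⟨φ, hφ, hc, he⟩ := a.exists_reparam b m1 m1 h
  have hc' : ContinuousAt φ 1 := hc.self_of_nhds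
  have hpos : ∀ᶠ u in 𝓝 (1 : ℝ), 0 < φ u := hc'.eventually_const_lt (by rw [hφ]; exact one_pos)
  obtain ⟨ε, hε, H⟩ := Metric.eventually_nhds_iff.1 (hc.and (he.and hpos))
  obtain ⟨u₀, hu0, hu1⟩ := exists_between (max_lt one_pos (by linarith : 1 - ε < 1))
  rw [max_lt_iff] at hu0
  have H' : ∀ u ∈ Set.Icc u₀ 1, ContinuousAt φ u ∧ a.pt u = b.pt (φ u) ∧ 0 < φ u := by
    intro u hu
    refine H ?_
    rw [Real.dist_eq, abs_lt]
    constructor <;> linarith [hu.1, hu.2]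
  refine ⟨φ, u₀, ⟨hu0.1, hu1⟩, fun u hu => (H' u hu).1.continuousWithinAt, hφ, ?_,
    fun u hu => (H' u hu).2.1⟩
  obtain ⟨-, g1, g2⟩ := H' u₀ ⟨le_rfl, hu1.le⟩
  by_contra! hle
  rcases hle.eq_or_lt with heq | hlt
  · rw [heq] at g1
    exact h1 u₀ ⟨hu0.1, hu1⟩ g1
  · exact hd u₀ ⟨hu0.1, hu1⟩ _ ⟨g2, hlt⟩ g1

/-- At most two leaf arcs with disjoint interiors end at the same point. -/
theorem false_of_three (a b c : LeafArc F) (hab : a.pt 1 = b.pt 1) (hcb : c.pt 1 = b.pt 1)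
    (dab : ∀ u ∈ Set.Ioo (0 : ℝ) 1, ∀ v ∈ Set.Ioo (0 : ℝ) 1, a.pt u ≠ b.pt v)
    (dcb : ∀ u ∈ Set.Ioo (0 : ℝ) 1, ∀ v ∈ Set.Ioo (0 : ℝ) 1, c.pt u ≠ b.pt v)
    (dac : ∀ u ∈ Set.Ioo (0 : ℝ) 1, ∀ v ∈ Set.Ioo (0 : ℝ) 1, a.pt u ≠ c.pt v)
    (ha : ∀ u ∈ Set.Ioo (0 : ℝ) 1, a.pt u ≠ b.pt 1)
    (hc : ∀ u ∈ Set.Ioo (0 : ℝ) 1, c.pt u ≠ b.pt 1) : False := by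
  obtain ⟨φ, u, hu, cφ, φ1, φu, eφ⟩ := a.exists_reparam_gt b hab dab ha
  obtain ⟨ψ, v, hv, cψ, ψ1, ψv, eψ⟩ := c.exists_reparam_gt b hcb dcb hc
  -- Both `a` and `c` continue `b` beyond parameter `1`, so both pass through the point of `b` with
  -- parameter `y > 1`, against their disjointness.
  let y := min (φ u) (ψ v)
  have hy : 1 < y := lt_min φu ψv
  obtain ⟨u', hu', hu'y⟩ := intermediate_value_Icc' hu.2.le cφ
    (show y ∈ Set.Icc (φ 1) (φ u) from ⟨by rw [φ1]; exact hy.le, min_le_left _ _⟩)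
  obtain ⟨v', hv', hv'y⟩ := intermediate_value_Icc' hv.2.le cψ
    (show y ∈ Set.Icc (ψ 1) (ψ v) from ⟨by rw [ψ1]; exact hy.le, min_le_right _ _⟩)
  have hu1 : u' ≠ 1 := by rintro rfl; linarith
  have hv1 : v' ≠ 1 := by rintro rfl; linarith
  refine dac u' ⟨hu.1.trans_le hu'.1, lt_of_le_of_ne hu'.2 hu1⟩ v'
    ⟨hv.1.trans_le hv'.1, lt_of_le_of_ne hv'.2 hv1⟩ ?_
  rw [eφ u' hu', eψ v' hv', hu'y, hv'y]

end LeafArc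

/-! ### Non-existence of foliations -/

/-- A continuous function from `0` to a positive value runs, on some interval, from `0` to some
`1 / (n + 1)` through smaller positive values. -/
theorem exists_first_crossing {W : ℝ → ℝ} (hW : ContinuousOn W (Set.Icc 0 1))
    (hpos : ∀ u ∈ Set.Icc (0 : ℝ) 1, 0 ≤ W u) (h0 : W 0 = 0) (h1 : 0 < W 1) :
    ∃ (n : ℕ) (u v : ℝ), 0 ≤ u ∧ u < v ∧ v ≤ 1 ∧ W u = 0 ∧ W v = 1 / ((n : ℝ) + 1) ∧
      ∀ t ∈ Set.Ioo u v, 0 < W t ∧ W t < 1 / ((n : ℝ) + 1) := by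
  obtain ⟨n, hn⟩ := exists_nat_one_div_lt h1
  have hn0 : 0 < 1 / ((n : ℝ) + 1) := by positivity
  have c0 : IsCompact (Set.Icc (0 : ℝ) 1 ∩ W ⁻¹' {0}) :=
    isCompact_Icc.of_isClosed_subset (hW.preimage_isClosed_of_isClosed isClosed_Icc
      isClosed_singleton) Set.inter_subset_left
  obtain ⟨u, ⟨hu, hWu⟩, hmax⟩ := c0.exists_isGreatest ⟨0, by simp, h0⟩
  have hWu : W u = 0 := hWu
  have hsub : Set.Icc u 1 ⊆ Set.Icc 0 1 := Set.Icc_subset_Icc_left hu.1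
  obtain ⟨w, hw, hWw⟩ := intermediate_value_Icc hu.2 (hW.mono hsub)
    (show 1 / ((n : ℝ) + 1) ∈ Set.Icc (W u) (W 1) from ⟨by rw [hWu]; exact hn0.le, hn.le⟩)
  have c1 : IsCompact (Set.Icc u 1 ∩ W ⁻¹' {1 / ((n : ℝ) + 1)}) :=
    isCompact_Icc.of_isClosed_subset ((hW.mono hsub).preimage_isClosed_of_isClosed isClosed_Icc
      isClosed_singleton) Set.inter_subset_left
  obtain ⟨v, ⟨hv, hWv⟩, hmin⟩ := c1.exists_isLeast ⟨w, hw, hWw⟩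
  have hWv : W v = 1 / ((n : ℝ) + 1) := hWv
  have huv : u < v := lt_of_le_of_ne hv.1 (by rintro rfl; rw [hWu] at hWv; exact hn0.ne hWv)
  refine ⟨n, u, v, hu.1, huv, hv.2, hWu, hWv, fun t ht => ⟨?_, ?_⟩⟩
  · have htI : t ∈ Set.Icc (0 : ℝ) 1 := ⟨hu.1.trans ht.1.le, ht.2.le.trans hv.2⟩
    refine lt_of_le_of_ne (hpos t htI) fun h => ?_
    exact absurd (hmax ⟨htI, h.symm⟩) (not_le.2 ht.1)
  · by_contra! hge
    obtain ⟨t', ht', hWt'⟩ := intermediate_value_Icc ht.1.le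
      (hW.mono ((Set.Icc_subset_Icc_right (ht.2.le.trans hv.2)).trans hsub))
      (show 1 / ((n : ℝ) + 1) ∈ Set.Icc (W u) (W t) from ⟨by rw [hWu]; exact hn0.le, hge⟩)
    exact absurd (hmin ⟨⟨ht'.1, ht'.2.trans (ht.2.le.trans hv.2)⟩, hWt'⟩)
      (not_le.2 (ht'.2.trans_lt ht.2))

/-- After the last time at level `c`, a smaller value would force another passage through `c` on the
way to `W 1`. This trims a landing arc to a curve that stays in a vertical strip. -/
theorem exists_last_crossing {W : ℝ → ℝ} (hW : ContinuousOn W (Set.Icc 0 1)) {c : ℝ}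
    (h0 : W 0 = 0) (hc : 0 < c) (h1 : c < W 1) :
    ∃ u, 0 < u ∧ u < 1 ∧ W u = c ∧ ∀ t ∈ Set.Icc u 1, c ≤ W t := by
  obtain ⟨w, hw, hWw⟩ := intermediate_value_Icc zero_le_one hW
    (show c ∈ Set.Icc (W 0) (W 1) from ⟨by rw [h0]; exact hc.le, h1.le⟩)
  have c0 : IsCompact (Set.Icc (0 : ℝ) 1 ∩ W ⁻¹' {c}) :=
    isCompact_Icc.of_isClosed_subset (hW.preimage_isClosed_of_isClosed isClosed_Icc
      isClosed_singleton) Set.inter_subset_left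
  obtain ⟨u, ⟨hu, hWu⟩, hmax⟩ := c0.exists_isGreatest ⟨w, hw, hWw⟩
  have hWu : W u = c := hWu
  refine ⟨u, lt_of_le_of_ne hu.1 ?_, lt_of_le_of_ne hu.2 ?_, hWu, fun t ht => ?_⟩
  · rintro rfl; linarith
  · rintro rfl; linarith
  · by_contra! hlt
    obtain ⟨t', ht', hWt'⟩ := intermediate_value_Icc ht.2
      (hW.mono (Set.Icc_subset_Icc_left (hu.1.trans ht.1)))
      (show c ∈ Set.Icc (W t) (W 1) from ⟨hlt.le, h1.le⟩)
    have := hmax ⟨⟨hu.1.trans (ht.1.trans ht'.1), ht'.2⟩, hWt'⟩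
    have htu : t = u := le_antisymm (ht'.1.trans this) ht.1
    rw [htu, hWu] at hlt
    exact lt_irrefl _ hlt

/-- A monotone real function on an uncountable set of countable ordinals takes some value at least
three times. -/
theorem exists_three_eq_of_monotoneOn {A : Set (Set.Iio (ω₁ : Ordinal.{0}))} (hA : ¬ A.Countable)
    {ρ : Set.Iio (ω₁ : Ordinal.{0}) → ℝ} (hρ : MonotoneOn ρ A) :
    ∃ α ∈ A, ∃ β ∈ A, ∃ γ ∈ A, α < β ∧ β < γ ∧ ρ α = ρ β ∧ ρ β = ρ γ := by
  have hne : ∀ q : ℚ, ∃ b : Set.Iio (ω₁ : Ordinal.{0}), (∃ α ∈ A, (q : ℝ) < ρ α) →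
      b ∈ A ∧ (q : ℝ) < ρ b := by
    intro q
    by_cases h : ∃ α ∈ A, (q : ℝ) < ρ α
    · obtain ⟨α, h1, h2⟩ := h
      exact ⟨α, fun _ => ⟨h1, h2⟩⟩
    · exact ⟨⟨0, Ordinal.omega_pos 1⟩, fun h' => absurd h' h⟩
  choose b hb using hne
  have hIic : ∀ β : Set.Iio (ω₁ : Ordinal.{0}), (Set.Iic β).Countable := by
    intro β
    have h1 : (Set.Iio (Order.succ β.1)).Countable := countable_Iio_of_lt_omega_one
      ((Cardinal.isSuccLimit_omega 1).succ_lt β.2)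
    refine (h1.preimage Subtype.val_injective).mono fun α hα => ?_
    exact Order.lt_succ_iff.2 (show α.1 ≤ β.1 from hα)
  -- The ordinal `b q` witnesses that `ρ` exceeds `q` on `A`, if it does at all. Beyond all these
  -- witnesses `ρ` has reached its maximum on `A`, so it is constant there.
  have hC : (⋃ q : ℚ, Set.Iic (b q)).Countable := Set.countable_iUnion fun q => hIic _
  have next : ∀ S : Set (Set.Iio (ω₁ : Ordinal.{0})), S.Countable → ∃ α ∈ A, α ∉ S := by
    intro S hS
    by_contra! h
    exact hA (hS.mono h)
  obtain ⟨α, hα, hαC⟩ := next _ hC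
  obtain ⟨β, hβ, hβα⟩ := next _ (hIic α)
  obtain ⟨γ, hγ, hγβ⟩ := next _ (hIic β)
  have hαβ : α < β := not_le.1 hβα
  have hβγ : β < γ := not_le.1 hγβ
  have key : ∀ δ ∈ A, ρ δ ≤ ρ α := by
    intro δ hδ
    by_contra! h
    obtain ⟨q, h1, h2⟩ := exists_rat_btwn h
    obtain ⟨h3, h4⟩ := hb q ⟨δ, hδ, h2⟩
    have : b q ≤ α := by
      by_contra! hlt
      exact hαC (Set.mem_iUnion.2 ⟨q, hlt.le⟩)
    linarith [hρ h3 hα this]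
  have e1 : ρ α = ρ β := le_antisymm (hρ hα hβ hαβ.le) (key β hβ)
  have e2 : ρ α = ρ γ := le_antisymm (hρ hα hγ (hαβ.trans hβγ).le) (key γ hγ)
  exact ⟨α, hα, β, hβ, γ, hγ, hαβ, hβγ, e1, e1 ▸ e2⟩

namespace MoorizedNyikos

variable {f : Ordinal.{0} → ℕ → ℕ} (hf : IsNyikosSeq f) (α β : Set.Iio (ω₁ : Ordinal.{0}))
  {K : Set (MoorizedNyikos f)} {F : Foliation (Kᶜ : Set (MoorizedNyikos f))}

/-- A leaf arc in the chart around a folded interval that runs from the interval to the line of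
points of width `1 / (n + 1)`. -/
structure IsLanding (n : ℕ) (a : LeafArc F) : Prop where
  mem_range : ∀ u ∈ Set.Icc (0 : ℝ) 1, (a.pt u : MoorizedNyikos f) ∈ Set.range (ofParabola hf α)
  width_zero : width (a.pt 0 : MoorizedNyikos f) = 0
  width_one : width (a.pt 1 : MoorizedNyikos f) = 1 / ((n : ℝ) + 1)
  width_pos : ∀ u ∈ Set.Ioo (0 : ℝ) 1, 0 < width (a.pt u : MoorizedNyikos f)
  width_lt : ∀ u ∈ Set.Ioo (0 : ℝ) 1, width (a.pt u : MoorizedNyikos f) < 1 / ((n : ℝ) + 1)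

/-- An injective curve through the tip does not stay in the folded interval. -/
theorem exists_width_pos {γ : ℝ → MoorizedNyikos f} {x₀ δ : ℝ} (hδ : 0 < δ)
    (hγ : ContinuousOn γ (Set.Icc (x₀ - δ) (x₀ + δ)))
    (hinj : Set.InjOn γ (Set.Icc (x₀ - δ) (x₀ + δ)))
    (hmem : ∀ x ∈ Set.Icc (x₀ - δ) (x₀ + δ), γ x ∈ Set.range (ofParabola hf α))
    (h0 : γ x₀ = tip hf α) : ∃ x ∈ Set.Icc (x₀ - δ) (x₀ + δ), 0 < width (γ x) := by
  by_contra! hcon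
  have hw : ∀ x ∈ Set.Icc (x₀ - δ) (x₀ + δ), width (γ x) = 0 := fun x hx =>
    le_antisymm (hcon x hx) (width_nonneg hf _)
  have : Nonempty ParabolaRegion := ⟨⟨0, by norm_num⟩⟩
  let E := (isOpenEmbedding_ofParabola hf α).toOpenPartialHomeomorph (ofParabola hf α)
  have hE : ∀ w, E.symm (ofParabola hf α w) = w := fun w =>
    E.left_inv (x := w) (by simp [E])
  let ψ : ℝ → ℝ := fun x => (E.symm (γ x)).1.re
  have hψ : ContinuousOn ψ (Set.Icc (x₀ - δ) (x₀ + δ)) := by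
    refine (Complex.continuous_re.comp continuous_subtype_val).comp_continuousOn
      (E.continuousOn_symm.comp hγ fun x hx => ?_)
    have := hmem x hx
    simpa [E] using this
  have hre : ∀ x ∈ Set.Icc (x₀ - δ) (x₀ + δ), ∃ w, γ x = ofParabola hf α w ∧ ψ x = w.1.re ∧
      0 ≤ w.1.re ∧ w.1.im = 0 := by
    intro x hx
    obtain ⟨w, hxw⟩ := hmem x hx
    refine ⟨w, hxw.symm, by simp only [ψ, ← hxw, hE], ?_⟩
    rw [← width_ofParabola_eq_zero_iff hf α, hxw]
    exact hw x hx
  have hψinj : Set.InjOn ψ (Set.Icc (x₀ - δ) (x₀ + δ)) := by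
    intro x hx y hy hxy
    obtain ⟨w, h1, h2, -, h3⟩ := hre x hx
    obtain ⟨w', h1', h2', -, h3'⟩ := hre y hy
    refine hinj hx hy ?_
    rw [h1, h1']
    congr 1
    exact Subtype.ext (Complex.ext (by rw [← h2, ← h2', hxy]) (by rw [h3, h3']))
  have m0 : x₀ ∈ Set.Icc (x₀ - δ) (x₀ + δ) := ⟨by linarith, by linarith⟩
  have ml : x₀ - δ ∈ Set.Icc (x₀ - δ) (x₀ + δ) := ⟨by linarith, by linarith⟩
  have mr : x₀ + δ ∈ Set.Icc (x₀ - δ) (x₀ + δ) := ⟨by linarith, by linarith⟩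
  have hψ0 : ψ x₀ = 0 := by simp only [ψ, h0, tip, hE, Complex.zero_re]
  have hnn : ∀ x ∈ Set.Icc (x₀ - δ) (x₀ + δ), 0 ≤ ψ x := by
    intro x hx
    obtain ⟨w, -, h2, h3, -⟩ := hre x hx
    rwa [h2]
  -- A continuous injective function on an interval is strictly monotone. It cannot vanish at the
  -- midpoint and be nonnegative on both sides.
  rcases hψ.strictMonoOn_of_injOn_Icc' (by linarith) hψinj with hm | hm
  · linarith [hm ml m0 (by linarith), hnn _ ml]
  · linarith [hm m0 mr (by linarith), hnn _ mr]

/-- The plaque through the tip is an injective curve with the tip in its interior, so some point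
near the tip has positive width. The segment towards that point is trimmed between the last zero of
the width and the next time the width is some `1/(n+1)`. The landing arc thus starts on the folded
interval, not necessarily at the tip. -/
theorem exists_isLanding (hα : tip hf α ∉ K) : ∃ (n : ℕ) (a : LeafArc F), IsLanding hf α n a := by
  obtain ⟨e, heF, hsrc⟩ := F.covers ⟨tip hf α, hα⟩
  obtain ⟨⟨x₀, y₀⟩, hp⟩ : ∃ p, e ⟨tip hf α, hα⟩ = p := ⟨_, rfl⟩
  have hp0 : (x₀, y₀) ∈ e.target := hp ▸ e.map_source hsrc
  let γ : ℝ → (Kᶜ : Set (MoorizedNyikos f)) := fun x => e.symm (x, y₀)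
  have hγ0 : γ x₀ = ⟨tip hf α, hα⟩ := by
    change e.symm (x₀, y₀) = _
    rw [← hp, e.left_inv hsrc]
  have hcγ : ∀ x, (x, y₀) ∈ e.target → ContinuousAt γ x := fun x hx =>
    ContinuousAt.comp (f := fun x => (x, y₀)) (e.continuousAt_symm hx) (by fun_prop)
  have hline : Continuous fun x : ℝ => (x, y₀) := by fun_prop
  have h1 : ∀ᶠ x in 𝓝 x₀, (x, y₀) ∈ e.target :=
    hline.continuousAt.eventually (e.open_target.mem_nhds hp0)
  have h2 : ∀ᶠ x in 𝓝 x₀, (γ x : MoorizedNyikos f) ∈ Set.range (ofParabola hf α) := by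
    refine (continuousAt_subtype_val.comp (hcγ x₀ hp0)).eventually
      ((isOpenEmbedding_ofParabola hf α).isOpen_range.mem_nhds ?_)
    simp only [Function.comp_apply, hγ0]
    exact ⟨_, rfl⟩
  obtain ⟨ε, hε, hball⟩ := Metric.eventually_nhds_iff.1 (h1.and h2)
  have hδ : 0 < ε / 2 := by linarith
  have hI : ∀ x ∈ Set.Icc (x₀ - ε / 2) (x₀ + ε / 2), (x, y₀) ∈ e.target ∧
      (γ x : MoorizedNyikos f) ∈ Set.range (ofParabola hf α) := by
    intro x hx
    refine hball ?_
    rw [Real.dist_eq, abs_lt]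
    constructor <;> linarith [hx.1, hx.2]
  obtain ⟨x₁, hx₁, hw₁⟩ := exists_width_pos hf α (γ := fun x => (γ x : MoorizedNyikos f)) hδ
    (fun x hx => (continuousAt_subtype_val.comp (hcγ x (hI x hx).1)).continuousWithinAt)
    (fun x hx y hy hxy => by
      have := e.symm.injOn (hI x hx).1 (hI y hy).1 (Subtype.ext hxy)
      exact congrArg Prod.fst this)
    (fun x hx => (hI x hx).2) (by simp only [hγ0])
  have hseg : ∀ u ∈ Set.Icc (0 : ℝ) 1, x₀ + u * (x₁ - x₀) ∈ Set.Icc (x₀ - ε / 2) (x₀ + ε / 2) := by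
    rintro u ⟨hu0, hu1⟩
    have hc := (convex_Icc (x₀ - ε / 2) (x₀ + ε / 2)).add_smul_sub_mem
      (⟨by linarith, by linarith⟩ : x₀ ∈ Set.Icc (x₀ - ε / 2) (x₀ + ε / 2)) hx₁ ⟨hu0, hu1⟩
    simpa using hc
  let W : ℝ → ℝ := fun u => width (γ (x₀ + u * (x₁ - x₀)) : MoorizedNyikos f)
  have hWc : ContinuousOn W (Set.Icc 0 1) := by
    intro u hu
    have g1 : ContinuousAt (fun x => width (γ x : MoorizedNyikos f)) (x₀ + u * (x₁ - x₀)) :=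
      (continuous_width hf).continuousAt.comp
        (continuousAt_subtype_val.comp (hcγ _ (hI _ (hseg u hu)).1))
    exact (ContinuousAt.comp (f := fun u : ℝ => x₀ + u * (x₁ - x₀)) g1
      (by fun_prop)).continuousWithinAt
  obtain ⟨n, u, v, hu0, huv, hv1, hWu, hWv, hW⟩ := exists_first_crossing hWc
    (fun u _ => width_nonneg hf _)
    (by simp only [W, zero_mul, add_zero, hγ0]; exact width_tip hf α)
    (by simpa only [W, one_mul, add_sub_cancel] using hw₁)
  have hx01 : x₁ - x₀ ≠ 0 := by
    intro h
    rw [sub_eq_zero.1 h, hγ0] at hw₁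
    exact hw₁.ne' (width_tip hf α)
  have hmem : ∀ t ∈ Set.Icc (0 : ℝ) 1, u + t * (v - u) ∈ Set.Icc (0 : ℝ) 1 := by
    rintro t ⟨ht0, ht1⟩
    constructor
    · nlinarith
    · nlinarith
  have hlin : ∀ t : ℝ, x₀ + u * (x₁ - x₀) + t * ((v - u) * (x₁ - x₀)) =
      x₀ + (u + t * (v - u)) * (x₁ - x₀) := fun t => by ring
  let a : LeafArc F :=
    { chart := e
      chart_mem := heF
      start := x₀ + u * (x₁ - x₀)
      dir := (v - u) * (x₁ - x₀)
      height := y₀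
      dir_ne := mul_ne_zero (sub_ne_zero.2 huv.ne') hx01
      mem_target := fun t ht => by
        rw [hlin]
        exact (hI _ (hseg _ (hmem t ht))).1 }
  have ha : ∀ t, a.pt t = γ (x₀ + (u + t * (v - u)) * (x₁ - x₀)) := fun t => by
    rw [← hlin]
    rfl
  have hio : ∀ t ∈ Set.Ioo (0 : ℝ) 1, u + t * (v - u) ∈ Set.Ioo u v := by
    rintro t ⟨ht0, ht1⟩
    constructor
    · nlinarith
    · nlinarith
  refine ⟨n, a, ⟨fun t ht => ?_, ?_, ?_, fun t ht => ?_, fun t ht => ?_⟩⟩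
  · rw [ha]
    exact (hI _ (hseg _ (hmem t ht))).2
  · rw [ha, zero_mul, add_zero]
    exact hWu
  · rw [ha, one_mul, add_sub_cancel]
    exact hWv
  · rw [ha]
    exact (hW _ (hio t ht)).1
  · rw [ha]
    exact (hW _ (hio t ht)).2

/-! ### Disjointness and order of the landing arcs. -/

variable {hf α β} {n : ℕ} {a b : LeafArc F}

theorem IsLanding.continuousOn_width (_ : IsLanding hf α n a) :
    ContinuousOn (fun u => width (a.pt u : MoorizedNyikos f)) (Set.Icc 0 1) := fun _ hu =>
  ((continuous_width hf).continuousAt.comp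
    (continuousAt_subtype_val.comp (a.continuousAt_pt hu))).continuousWithinAt

theorem IsLanding.ne_zero (ha : IsLanding hf α n a) (hb : IsLanding hf β n b) {u : ℝ}
    (hu : u ∈ Set.Ioo (0 : ℝ) 1) : a.pt u ≠ b.pt 0 := fun h => by
  have := ha.width_pos u hu
  rw [h, hb.width_zero] at this
  exact lt_irrefl _ this

theorem IsLanding.ne_one (ha : IsLanding hf α n a) (hb : IsLanding hf β n b) {u : ℝ}
    (hu : u ∈ Set.Ioo (0 : ℝ) 1) : a.pt u ≠ b.pt 1 := fun h => by
  have := ha.width_lt u hu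
  rw [h, hb.width_one] at this
  exact lt_irrefl _ this

/-- Arcs landing at different folded intervals have disjoint interiors. -/
theorem IsLanding.disjoint (ha : IsLanding hf α n a) (hb : IsLanding hf β n b) (hαβ : α ≠ β)
    {u v : ℝ} (hu : u ∈ Set.Ioo (0 : ℝ) 1) (hv : v ∈ Set.Ioo (0 : ℝ) 1) : a.pt u ≠ b.pt v := by
  intro h
  have := t2Space hf
  -- The width lies strictly between `0` and `1/(n+1)` inside `a`, so `a` avoids both ends of `b`.
  -- One common interior point would then put the whole interior of `a` into the chart of `β`,
  -- including points of arbitrarily small width.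
  have hsub := a.mapsTo_of_meets b (fun u hu => ha.ne_zero hb hu) (fun u hu => ha.ne_one hb hu)
    hu hv h
  obtain ⟨δ, hδ, H⟩ := exists_le_width_of_ne hf hαβ
  have hc : ContinuousAt (fun u => width (a.pt u : MoorizedNyikos f)) 0 :=
    (continuous_width hf).continuousAt.comp
      (continuousAt_subtype_val.comp (a.continuousAt_pt ⟨le_rfl, zero_le_one⟩))
  have hev : ∀ᶠ u in 𝓝 (0 : ℝ), width (a.pt u : MoorizedNyikos f) < δ :=
    hc.eventually_lt_const (by simpa only [ha.width_zero] using hδ)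
  have hev' : ∀ᶠ u in 𝓝[>] (0 : ℝ), u ∈ Set.Ioo (0 : ℝ) 1 := Ioo_mem_nhdsGT one_pos
  obtain ⟨t, ht, ht'⟩ := ((hev.filter_mono nhdsWithin_le_nhds).and hev').exists
  obtain ⟨s, hs, hst⟩ := hsub t ht'
  refine absurd ht (not_lt.2 (H _ ⟨ha.mem_range t (Set.Ioo_subset_Icc_self ht'), ?_⟩))
  rw [← hst]
  exact hb.mem_range s (Set.Ioo_subset_Icc_self hs)

theorem IsLanding.eq_of_coord_eq (ha : IsLanding hf α n a) (hb : IsLanding hf β n b)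
    (h : (coord (a.pt 1 : MoorizedNyikos f)).2 = (coord (b.pt 1 : MoorizedNyikos f)).2) :
    a.pt 1 = b.pt 1 := by
  have h1 : 0 < width (a.pt 1 : MoorizedNyikos f) := by rw [ha.width_one]; positivity
  have h2 : 0 < width (b.pt 1 : MoorizedNyikos f) := by rw [hb.width_one]; positivity
  refine Subtype.ext (MoorizedNyikos.eq_of_coord_eq hf h1 h2 (Prod.ext ?_ h))
  rw [coord_fst_of_width_pos hf h1, coord_fst_of_width_pos hf h2, ha.width_one, hb.width_one]

/-- The part of a landing arc of width at least `c`, as a curve in the complex plane. -/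
theorem IsLanding.exists_curve (ha : IsLanding hf α n a) {c : ℝ} (hc : 0 < c)
    (hcn : c < 1 / ((n : ℝ) + 1)) : ∃ (κ : ℝ → ℝ) (A : ℝ → ℂ), ContinuousOn A (Set.Icc 0 1) ∧
      κ 1 = 1 ∧ (∀ t ∈ Set.Icc (0 : ℝ) 1, κ t ∈ Set.Ioc (0 : ℝ) 1) ∧
      (∀ t ∈ Set.Icc (0 : ℝ) 1, (A t).re = width (a.pt (κ t) : MoorizedNyikos f) ∧
        (A t).im = (coord (a.pt (κ t) : MoorizedNyikos f)).2 ∧ c ≤ (A t).re ∧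
        (A t).re ≤ 1 / ((n : ℝ) + 1)) ∧ (A 0).re = c := by
  obtain ⟨u, hu0, hu1, hWu, hW⟩ := exists_last_crossing ha.continuousOn_width ha.width_zero hc
    (by rw [ha.width_one]; exact hcn)
  let κ : ℝ → ℝ := fun t => u + t * (1 - u)
  have hκ : ∀ t ∈ Set.Icc (0 : ℝ) 1, κ t ∈ Set.Icc u 1 := by
    rintro t ⟨ht0, ht1⟩
    constructor <;> simp only [κ] <;> nlinarith
  have hpos : ∀ t ∈ Set.Icc (0 : ℝ) 1, 0 < width (a.pt (κ t) : MoorizedNyikos f) := fun t ht =>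
    hc.trans_le (hW _ (hκ t ht))
  have hκI : ∀ t ∈ Set.Icc (0 : ℝ) 1, κ t ∈ Set.Icc (0 : ℝ) 1 := fun t ht =>
    ⟨hu0.le.trans (hκ t ht).1, (hκ t ht).2⟩
  refine ⟨κ, fun t => Complex.equivRealProdCLM.symm (coord (a.pt (κ t) : MoorizedNyikos f)),
    fun t ht => ?_, by simp [κ], fun t ht => ⟨hu0.trans_le (hκ t ht).1, (hκ t ht).2⟩,
    fun t ht => ?_, ?_⟩
  · refine (Complex.equivRealProdCLM.symm.continuous.continuousAt.comp ?_).continuousWithinAt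
    have g1 : ContinuousAt (fun u => coord (a.pt u : MoorizedNyikos f)) (κ t) :=
      ContinuousAt.comp (f := fun u => (a.pt u : MoorizedNyikos f))
        (continuousAt_coord hf (hpos t ht))
        (continuousAt_subtype_val.comp (a.continuousAt_pt (hκI t ht)))
    exact ContinuousAt.comp (f := κ) g1 (by fun_prop)
  · have hre : (Complex.equivRealProdCLM.symm (coord (a.pt (κ t) : MoorizedNyikos f))).re =
        width (a.pt (κ t) : MoorizedNyikos f) := by
      rw [← coord_fst_of_width_pos hf (hpos t ht)]
      simp
    refine ⟨hre, by simp, ?_, ?_⟩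
    · rw [hre]
      exact hW _ (hκ t ht)
    · rw [hre]
      rcases (hκ t ht).2.eq_or_lt with h1 | h1
      · rw [h1, ha.width_one]
      · exact (ha.width_lt _ ⟨hu0.trans_le (hκ t ht).1, h1⟩).le
  · have h0 : κ 0 = u := by simp [κ]
    have := coord_fst_of_width_pos hf (hpos 0 (by simp))
    rw [h0, hWu] at this
    simp only [h0]
    rw [← this]
    simp

/-- The arcs landing at the folded intervals start in the order of the ordinals. -/
theorem IsLanding.coord_le (ha : IsLanding hf α n a) (hb : IsLanding hf β n b) (hαβ : α < β) :
    (coord (a.pt 1 : MoorizedNyikos f)).2 ≤ (coord (b.pt 1 : MoorizedNyikos f)).2 := by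
  by_cases heq : a.pt 1 = b.pt 1
  · rw [heq]
  obtain ⟨δ, hδ, H⟩ := exists_coord_snd_lt hf hαβ
  -- At width `c < δ` the order of the two curves is that of their strips. Between the widths `c`
  -- and `1/(n+1)` the order cannot change.
  obtain ⟨c, hc0, hc⟩ := exists_between (lt_min hδ (by positivity : 0 < 1 / ((n : ℝ) + 1)))
  rw [lt_min_iff] at hc
  obtain ⟨κ, A, cA, κ1, hκ, hA, A0⟩ := ha.exists_curve hc0 hc.2
  obtain ⟨μ, B, cB, μ1, hμ, hB, B0⟩ := hb.exists_curve hc0 hc.2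
  have m0 : (0 : ℝ) ∈ Set.Icc (0 : ℝ) 1 := by simp
  have m1 : (1 : ℝ) ∈ Set.Icc (0 : ℝ) 1 := by simp
  have A1 : (A 1).re = 1 / ((n : ℝ) + 1) := by rw [(hA 1 m1).1, κ1, ha.width_one]
  have B1 : (B 1).re = 1 / ((n : ℝ) + 1) := by rw [(hB 1 m1).1, μ1, hb.width_one]
  have hd : ∀ t ∈ Set.Icc (0 : ℝ) 1, ∀ t' ∈ Set.Icc (0 : ℝ) 1, A t ≠ B t' := by
    intro t ht t' ht' hAB
    have p1 : 0 < width (a.pt (κ t) : MoorizedNyikos f) := by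
      rw [← (hA t ht).1]; exact hc0.trans_le (hA t ht).2.2.1
    have p2 : 0 < width (b.pt (μ t') : MoorizedNyikos f) := by
      rw [← (hB t' ht').1]; exact hc0.trans_le (hB t' ht').2.2.1
    have hpt : a.pt (κ t) = b.pt (μ t') := by
      refine Subtype.ext (MoorizedNyikos.eq_of_coord_eq hf p1 p2 (Prod.ext ?_ ?_))
      · rw [coord_fst_of_width_pos hf p1, coord_fst_of_width_pos hf p2, ← (hA t ht).1,
          ← (hB t' ht').1, hAB]
      · rw [← (hA t ht).2.1, ← (hB t' ht').2.1, hAB]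
    rcases (hκ t ht).2.eq_or_lt with h1 | h1 <;> rcases (hμ t' ht').2.eq_or_lt with h2 | h2
    · rw [h1, h2] at hpt
      exact heq hpt
    · rw [h1] at hpt
      exact hb.ne_one ha ⟨(hμ t' ht').1, h2⟩ hpt.symm
    · rw [h2] at hpt
      exact ha.ne_one hb ⟨(hκ t ht).1, h1⟩ hpt
    · exact ha.disjoint hb hαβ.ne ⟨(hκ t ht).1, h1⟩ ⟨(hμ t' ht').1, h2⟩ hpt
  have h0 : (A 0).im < (B 0).im := by
    rw [(hA 0 m0).2.1, (hB 0 m0).2.1]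
    obtain ⟨v, hv⟩ := ha.mem_range (κ 0) (Set.Ioc_subset_Icc_self (hκ 0 m0))
    obtain ⟨w, hw⟩ := hb.mem_range (μ 0) (Set.Ioc_subset_Icc_self (hμ 0 m0))
    have w1 := (hA 0 m0).1
    have w2 := (hB 0 m0).1
    rw [A0] at w1
    rw [B0] at w2
    rw [← hv, ← hw]
    refine H v w ?_ ?_ ?_
    · rw [hv, ← w1]; exact hc0
    · rw [hv, ← w1]; exact hc.1
    · rw [hv, hw, ← w1, ← w2]
  have := im_le_im_of_disjoint cA cB (fun t ht => (hA t ht).2.2) (fun t ht => (hB t ht).2.2)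
    A0 B0 A1 B1 hd h0
  rwa [(hA 1 m1).2.1, (hB 1 m1).2.1, κ1, μ1] at this

/-- Discarding the finitely many ordinals whose arcs meet `K`, pigeonhole gives one level `n` with
uncountably many landing arcs. The monotone heights of their ends coincide for three of them, which
contradicts `LeafArc.false_of_three`. -/
theorem isEmpty_foliation_compl (hf : IsNyikosSeq f) {K : Set (MoorizedNyikos f)}
    (hK : IsCompact K) : IsEmpty (Foliation (Kᶜ : Set (MoorizedNyikos f))) := by
  refine ⟨fun F => ?_⟩
  let D : Set (Set.Iio (ω₁ : Ordinal.{0})) := {α | (K ∩ arc hf α).Nonempty}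
  have hD : D.Finite := finite_setOf_arc_inter hf hK
  have hex : ∀ α, ∃ n, α ∉ D → ∃ a : LeafArc F, IsLanding hf α n a := by
    intro α
    by_cases hα : α ∈ D
    · exact ⟨0, fun h => absurd hα h⟩
    · obtain ⟨n, a, h⟩ := exists_isLanding hf α (K := K) (F := F)
        fun h => hα ⟨_, h, tip_mem_arc hf α⟩
      exact ⟨n, fun _ => ⟨a, h⟩⟩
  choose N hN using hex
  obtain ⟨n, hn⟩ : ∃ n, ¬ {α | α ∉ D ∧ N α = n}.Countable := by
    by_contra! h
    refine not_countable_Iio_omega_one ((hD.countable.union (Set.countable_iUnion h)).mono ?_)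
    intro α _
    by_cases hα : α ∈ D
    · exact Or.inl hα
    · exact Or.inr (Set.mem_iUnion.2 ⟨N α, hα, rfl⟩)
  -- `Option` supplies a value at the ordinals without a chosen arc. There `ρ` takes the irrelevant
  -- value `0`.
  have hex' : ∀ α, ∃ a : Option (LeafArc F), (α ∉ D ∧ N α = n) → ∃ a', a = some a' ∧
      IsLanding hf α n a' := by
    intro α
    by_cases hα : α ∉ D ∧ N α = n
    · obtain ⟨a, ha⟩ := hN α hα.1
      exact ⟨some a, fun _ => ⟨a, rfl, hα.2 ▸ ha⟩⟩
    · exact ⟨none, fun h => absurd h hα⟩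
  choose a ha using hex'
  let ρ : Set.Iio (ω₁ : Ordinal.{0}) → ℝ := fun α =>
    (a α).elim 0 fun a => (coord (a.pt 1 : MoorizedNyikos f)).2
  have hρ : MonotoneOn ρ {α | α ∉ D ∧ N α = n} := by
    intro α hα β hβ hαβ
    rcases hαβ.eq_or_lt with rfl | hlt
    · exact le_rfl
    obtain ⟨a', h1, h2⟩ := ha α hα
    obtain ⟨b', h3, h4⟩ := ha β hβ
    simp only [ρ, h1, h3]
    exact h2.coord_le h4 hlt
  obtain ⟨α, hα, β, hβ, γ, hγ, hαβ, hβγ, e1, e2⟩ := exists_three_eq_of_monotoneOn hn hρ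
  obtain ⟨a', a1, a2⟩ := ha α hα
  obtain ⟨b', b1, b2⟩ := ha β hβ
  obtain ⟨c', c1, c2⟩ := ha γ hγ
  simp only [ρ, a1, b1, c1] at e1 e2
  exact LeafArc.false_of_three a' b' c' (a2.eq_of_coord_eq b2 e1) (c2.eq_of_coord_eq b2 e2.symm)
    (fun u hu v hv => a2.disjoint b2 hαβ.ne hu hv) (fun u hu v hv => c2.disjoint b2 hβγ.ne' hu hv)
    (fun u hu v hv => a2.disjoint c2 (hαβ.trans hβγ).ne hu hv)
    (fun u hu => a2.ne_one b2 hu) (fun u hu => c2.ne_one b2 hu)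

end MoorizedNyikos

end

theorem mainTheorem11 :
    (∃ f : Ordinal.{0} → ℕ → ℕ, IsNyikosSeq f) ∧
    ∀ f : Ordinal.{0} → ℕ → ℕ, IsNyikosSeq f →
      IsSurface (MoorizedNyikos f) ∧
      TopologicalSpace.SeparableSpace (MoorizedNyikos f) ∧
      SimplyConnectedSpace (MoorizedNyikos f) ∧
      ¬ TopologicalSpace.MetrizableSpace (MoorizedNyikos f) ∧
      ∀ K : Set (MoorizedNyikos f), IsCompact K → IsEmpty (Foliation (Kᶜ : Set (MoorizedNyikos f))) :=
  ⟨⟨nyikosSeq, isNyikosSeq_nyikosSeq⟩, fun _ hf =>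
    ⟨MoorizedNyikos.isSurface hf, MoorizedNyikos.separableSpace hf,
      MoorizedNyikos.simplyConnectedSpace hf, MoorizedNyikos.not_metrizableSpace hf,
      fun _ hK => MoorizedNyikos.isEmpty_foliation_compl hf hK⟩⟩
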